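/- Let $n,k,D\ge 1$ be integers and $\lambda\in(0,1)$. Let $V_1,\dots,V_n$ be uniform on $[0,1]$ and let $E_{i,j}$, $1\le i,j\le n$, be standard Gaussian $\mathcal N(0,1)$, all these $n+n^2$ random variables being independent. Define the random $n\times n$ matrices $X$ and $Y$ by $$X_{i,j}=\phi_\lambda(V_i-V_j),\qquad \phi_\lambda(x)=\lambda\,\mathbf 1\{|x|\le k/n\},\qquad Y=X+E,$$ and let $$\mathrm{MMSE}_{\le D}=\inf_{f:\ \deg f\le D}\mathbb E\big[\|f(Y)-X\|_F^2\big],$$ where the infimum is over all maps $f:\mathbb R^{n\times n}\to\mathbb R^{n\times n}$ each of whose $n^2$ components is a real polynomial of total degree at most $D$ in the $n^2$ entries of its argument. Set $r_0=2\lambda^2(D+1)^4$. If $r_0<1$ and $(2k+1)^2\le n/2$, then $$\mathrm{MMSE}_{\le D}\ \ge\ 2\lambda^2k(n-1)-4\lambda^2k^2\Big(3+\frac{5r_0}{1-r_0}\Big).$$ -/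

import Mathlib

open MeasureTheory ProbabilityTheory

/-- The latent connection function `x ↦ lam * 1{|x| ≤ w}`. -/
noncomputable def bandFunction (lam w : ℝ) (x : ℝ) : ℝ :=
  lam * Set.indicator {t : ℝ | |t| ≤ w} (fun _ => (1 : ℝ)) x

/-- The signal matrix `X i j = φ (v i - v j)` of the latent position model. -/
def latentMatrix {n : ℕ} (φ : ℝ → ℝ) (v : Fin n → ℝ) : Matrix (Fin n) (Fin n) ℝ :=
  Matrix.of fun i j => φ (v i - v j)

/-- Squared Frobenius norm of a real square matrix. -/
def frobeniusSq {n : ℕ} (A : Matrix (Fin n) (Fin n) ℝ) : ℝ :=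
  ∑ i, ∑ j, A i j ^ 2

/-- Value at the data matrix `y` of the matrix-valued polynomial `f`, each entry of which is a
polynomial in the `n ^ 2` entries of the data matrix. -/
noncomputable def polyEval {n : ℕ}
    (f : Matrix (Fin n) (Fin n) (MvPolynomial (Fin n × Fin n) ℝ))
    (y : Matrix (Fin n) (Fin n) ℝ) : Matrix (Fin n) (Fin n) ℝ :=
  Matrix.of fun i j => MvPolynomial.eval (fun p => y p.1 p.2) (f i j)

/-- The smallest expected squared Frobenius error `E ‖f(Y) - X‖²` over all matrix-valued
polynomials `f` whose entries have total degree at most `D`. -/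
noncomputable def lowDegreeMMSE {Ω : Type*} [MeasurableSpace Ω] (P : Measure Ω) {n : ℕ}
    (X Y : Ω → Matrix (Fin n) (Fin n) ℝ) (D : ℕ) : ℝ :=
  ⨅ f : {f : Matrix (Fin n) (Fin n) (MvPolynomial (Fin n × Fin n) ℝ) //
      ∀ i j, (f i j).totalDegree ≤ D},
    ∫ ω, frobeniusSq (polyEval f.1 (Y ω) - X ω) ∂P

/-! The error is a sum over entries. Diagonal entries are bounded below by `0`; for an off-diagonal
entry `e` put `x = X e`, `t = k / n`, and consider one polynomial `F` of degree at most `D` in `Y =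
X + Z`, with `Z` the Gaussian noise.

Duality (`le_integral_sq_sub`): suppose a function `g(Z)` of the noise alone satisfies `E[F(Y) g(Z)]
= E[F(Y) x]` for all such `F`. Then `E(F - x)² - E x² + E g² = E(F - g)² ≥ 0`, so the error is at
least `E x² - E g²`. With `g = ∑ κ β / β! * H_β`, testing against Hermite products turns the
requirement into the moment-cumulant recursion, because `E[H_γ(c + Z) H_β(Z)] = β! * choose γ β * c
^ (γ - β)`. So `κ` is the joint cumulant of `x` with the entries of `X`, and `E g² = ∑ κ β² / β!`.

Cumulants: read `α` as a multigraph on the positions. Independence kills `κ α` unless each edge of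
`α` is connected to `e` (`bandCumulant_eq_zero`). When they are, exploring the graph vertex by
vertex costs a factor `2t` per new vertex, since a new position must fall within `t` of an earlier
one; the recursion then gives `|κ α| ≤ (d + 1)^d * lam^(d + 1) * (2t)^(|V| - 1)` for `d` edges and
vertex set `V` (`abs_bandCumulant_le`).

Summation: group the `α` with `d` edges by vertex set `U`. Then `|U| ≤ 2d + 2`, and the inverse
factorials over edges in `U × U` sum to `|U|^(2d) / d!`. The sum over `U` costs at most `(1 + 4t²)^n
≤ 2`, which is where the bound on `k` against `n` enters. Degree `d ≥ 1` contributes at most `4 * (2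
lam t)² * r₀^d`, a geometric series, and degree `0` at most `(2 lam t)²`. As `E x² ≥ lam² (2t -
4t²)`, multiplying by `n (n - 1)` and using `n t = k` gives the result. -/

/-! ### Functions all of whose moments are finite -/

/-- `F` belongs to `L^p` for every finite exponent `p`. -/
def HasFiniteMoments {S : Type*} [MeasurableSpace S] (F : S → ℝ) (μ : Measure S) : Prop :=
  ∀ p : NNReal, MemLp F p μ

namespace HasFiniteMoments

variable {S T : Type*} [MeasurableSpace S] [MeasurableSpace T] {μ : Measure S} {ν : Measure T}
  {F G : S → ℝ}

theorem integrable (hF : HasFiniteMoments F μ) : Integrable F μ :=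
  memLp_one_iff_integrable.1 (by simpa using hF 1)

theorem of_bound [IsFiniteMeasure μ] (hF : AEStronglyMeasurable F μ) (C : ℝ)
    (h : ∀ s, |F s| ≤ C) : HasFiniteMoments F μ :=
  fun _ => MemLp.of_bound hF C (Filter.Eventually.of_forall h)

theorem const [IsFiniteMeasure μ] (c : ℝ) : HasFiniteMoments (fun _ => c) μ :=
  fun _ => memLp_const c

theorem add (hF : HasFiniteMoments F μ) (hG : HasFiniteMoments G μ) :
    HasFiniteMoments (fun s => F s + G s) μ := fun p => (hF p).add (hG p)

theorem sub (hF : HasFiniteMoments F μ) (hG : HasFiniteMoments G μ) :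
    HasFiniteMoments (fun s => F s - G s) μ := fun p => (hF p).sub (hG p)

theorem mul (hF : HasFiniteMoments F μ) (hG : HasFiniteMoments G μ) :
    HasFiniteMoments (fun s => F s * G s) μ := fun p => by
  -- Hölder with both exponents equal to `2p`: closure under products is the reason to ask for all
  -- finite moments.
  have : ENNReal.HolderTriple ((2 * p : NNReal) : ENNReal) ((2 * p : NNReal) : ENNReal) p := by
    constructor
    rw [ENNReal.coe_mul, ENNReal.mul_inv (by simp) (by simp), ← add_mul]
    simp [ENNReal.inv_two_add_inv_two]
  exact (hG (2 * p)).mul' (hF (2 * p))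

theorem sum {ι : Type*} (s : Finset ι) {f : ι → S → ℝ} (h : ∀ i ∈ s, HasFiniteMoments (f i) μ) :
    HasFiniteMoments (fun a => ∑ i ∈ s, f i a) μ :=
  fun p => memLp_finsetSum s fun i hi => h i hi p

theorem prod [IsFiniteMeasure μ] {ι : Type*} (s : Finset ι) {f : ι → S → ℝ}
    (h : ∀ i ∈ s, HasFiniteMoments (f i) μ) :
    HasFiniteMoments (fun a => ∏ i ∈ s, f i a) μ := by
  classical
  induction s using Finset.induction with
  | empty => simpa using const 1
  | insert i s his ih =>
    simp only [Finset.prod_insert his]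
    exact (h i (by simp)).mul (ih fun j hj => h j (by simp [hj]))

theorem pow [IsFiniteMeasure μ] (hF : HasFiniteMoments F μ) (n : ℕ) :
    HasFiniteMoments (fun s => F s ^ n) μ := by
  simpa using prod (Finset.range n) (f := fun _ => F) fun _ _ => hF

theorem polynomial_eval [IsFiniteMeasure μ] (hF : HasFiniteMoments F μ) (p : Polynomial ℝ) :
    HasFiniteMoments (fun s => p.eval (F s)) μ := by
  simp only [Polynomial.eval_eq_sum_range]
  exact sum _ fun i _ => (const _).mul (hF.pow i)

theorem comp_measurePreserving {G : T → ℝ} (hG : HasFiniteMoments G ν) {e : S → T}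
    (he : MeasurePreserving e μ ν) : HasFiniteMoments (fun s => G (e s)) μ :=
  fun p => (hG p).comp_measurePreserving he

end HasFiniteMoments

theorem hasFiniteMoments_id_gaussianReal : HasFiniteMoments (fun x => x) (gaussianReal 0 1) :=
  fun p => memLp_id_gaussianReal p

/-! ### Hermite polynomials and Gaussian integration by parts -/

section Hermite

open Polynomial

theorem hasFiniteMoments_polynomial_gaussianReal (p : ℝ[X]) :
    HasFiniteMoments (fun x => p.eval x) (gaussianReal 0 1) :=
  hasFiniteMoments_id_gaussianReal.polynomial_eval p

theorem integrable_mul_polynomial_gaussianReal (p : ℝ[X]) :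
    Integrable (fun x => x * p.eval x) (gaussianReal 0 1) :=
  (hasFiniteMoments_id_gaussianReal.mul (hasFiniteMoments_polynomial_gaussianReal p)).integrable

theorem integrable_gaussianPDFReal_mul_polynomial (p : ℝ[X]) :
    Integrable (fun x => gaussianPDFReal 0 1 x * p.eval x) := by
  have h := (hasFiniteMoments_polynomial_gaussianReal p).integrable
  rw [gaussianReal_of_var_ne_zero _ one_ne_zero,
    integrable_withDensity_iff_integrable_smul' (measurable_gaussianPDF 0 1)
      (Filter.Eventually.of_forall fun _ => gaussianPDF_lt_top)] at h
  simpa [toReal_gaussianPDF] using h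

/-- Gaussian integration by parts (Stein's identity) for polynomials. -/
theorem integral_mul_polynomial_gaussianReal (p : ℝ[X]) :
    ∫ x, x * p.eval x ∂gaussianReal 0 1 = ∫ x, p.derivative.eval x ∂gaussianReal 0 1 := by
  have hpdf : ∀ x, HasDerivAt (gaussianPDFReal 0 1) (-(x * gaussianPDFReal 0 1 x)) x := by
    intro x
    have h1 : HasDerivAt (fun y : ℝ => -(y - 0) ^ 2 / (2 * ((1 : NNReal) : ℝ))) (-x) x := by
      have := (((hasDerivAt_id x).sub_const 0).pow 2).neg.div_const (2 * ((1 : NNReal) : ℝ))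
      exact this.congr_deriv (by simp; ring)
    have h2 := (h1.exp).const_mul (√(2 * Real.pi * ((1 : NNReal) : ℝ)))⁻¹
    exact h2.congr_deriv (by simp only [gaussianPDFReal]; ring)
  have hderiv : ∀ x, HasDerivAt (fun x => gaussianPDFReal 0 1 x * p.eval x)
      (gaussianPDFReal 0 1 x * (derivative p - X * p).eval x) x := by
    intro x
    exact ((hpdf x).mul (p.hasDerivAt x)).congr_deriv (by
      rw [eval_sub, eval_mul, eval_X]; ring)
  -- The Gaussian density times `p` has derivative equal to the density times `p' - x p`, and this
  -- derivative integrates to zero.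
  have h0 := integral_eq_zero_of_hasDerivAt_of_integrable hderiv
    (integrable_gaussianPDFReal_mul_polynomial _) (integrable_gaussianPDFReal_mul_polynomial _)
  have h1 : ∫ x, (derivative p - X * p).eval x ∂gaussianReal 0 1 = 0 := by
    rw [integral_gaussianReal_eq_integral_smul one_ne_zero]
    simpa using h0
  have h2 : ∫ x, (derivative p - X * p).eval x ∂gaussianReal 0 1
      = ∫ x, (derivative p).eval x ∂gaussianReal 0 1 - ∫ x, x * p.eval x ∂gaussianReal 0 1 := by
    rw [← integral_sub (hasFiniteMoments_polynomial_gaussianReal _).integrable]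
    · simp
    · exact integrable_mul_polynomial_gaussianReal _
  linarith

/-- The probabilists' Hermite polynomials with real coefficients. -/
noncomputable def realHermite (m : ℕ) : ℝ[X] := (hermite m).map (Int.castRingHom ℝ)

theorem realHermite_zero : realHermite 0 = 1 := by simp [realHermite]

theorem realHermite_succ (m : ℕ) :
    realHermite (m + 1) = X * realHermite m - derivative (realHermite m) := by
  simp [realHermite, hermite_succ, derivative_map]

theorem derivative_realHermite_succ (m : ℕ) :
    derivative (realHermite (m + 1)) = ((m : ℝ[X]) + 1) * realHermite m := by
  induction m with
  | zero => simp [realHermite_succ, realHermite_zero]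
  | succ m ih =>
    have h : derivative (derivative (realHermite (m + 1)))
        = ((m : ℝ[X]) + 1) * derivative (realHermite m) := by
      rw [ih]
      simp [derivative_mul]
    rw [realHermite_succ (m + 1), derivative_sub, derivative_mul, h, ih, realHermite_succ m]
    simp
    ring

theorem X_mul_realHermite_succ (m : ℕ) :
    X * realHermite (m + 1) = realHermite (m + 2) + ((m : ℝ[X]) + 1) * realHermite m := by
  rw [realHermite_succ (m + 1), derivative_realHermite_succ]
  ring

/-- Expand `H_(m+1) = y H_m - H_m'` at `y = c + x`. By Stein's identity the `x` part cancels the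
derivative and only the factor `c` survives. -/
theorem integral_realHermite_shift_succ (c : ℝ) (m : ℕ) :
    ∫ x, (realHermite (m + 1)).eval (c + x) ∂gaussianReal 0 1
      = c * ∫ x, (realHermite m).eval (c + x) ∂gaussianReal 0 1 := by
  have hcomp : ∀ q : ℝ[X], ∀ x, q.eval (c + x) = (q.comp (C c + X)).eval x := by
    intro q x; simp
  have hint : ∀ q : ℝ[X], Integrable (fun x => q.eval (c + x)) (gaussianReal 0 1) := by
    intro q
    simp only [hcomp]
    exact (hasFiniteMoments_polynomial_gaussianReal _).integrable
  have hint' : Integrable (fun x => x * (realHermite m).eval (c + x)) (gaussianReal 0 1) := by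
    simp only [hcomp]
    exact integrable_mul_polynomial_gaussianReal _
  have hstein : ∫ x, x * (realHermite m).eval (c + x) ∂gaussianReal 0 1
      = ∫ x, (derivative (realHermite m)).eval (c + x) ∂gaussianReal 0 1 := by
    simp only [hcomp]
    rw [integral_mul_polynomial_gaussianReal]
    simp [derivative_comp]
  have hsplit : ∀ x, (realHermite (m + 1)).eval (c + x)
      = c * (realHermite m).eval (c + x)
        + (x * (realHermite m).eval (c + x) - (derivative (realHermite m)).eval (c + x)) := by
    intro x
    rw [realHermite_succ]
    simp
    ring
  simp only [hsplit]
  rw [integral_add ((hint (realHermite m)).const_mul c)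
    (by exact hint'.sub (hint (derivative (realHermite m)))),
    integral_sub hint' (hint _), hstein, integral_const_mul]
  ring

theorem integral_realHermite_shift (c : ℝ) (m : ℕ) :
    ∫ x, (realHermite m).eval (c + x) ∂gaussianReal 0 1 = c ^ m := by
  induction m with
  | zero => simp [realHermite_zero]
  | succ m ih => rw [integral_realHermite_shift_succ, ih]; ring

/-- The operator `q ↦ x q - q'`, which raises `H_l` to `H_(l+1)`, is the adjoint of differentiation
under the Gaussian measure. -/
theorem integral_polynomial_mul_realHermite_succ (p : ℝ[X]) (l : ℕ) :
    ∫ x, p.eval x * (realHermite (l + 1)).eval x ∂gaussianReal 0 1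
      = ∫ x, (derivative p).eval x * (realHermite l).eval x ∂gaussianReal 0 1 := by
  have h := integral_mul_polynomial_gaussianReal (p * realHermite l)
  have hint : ∀ q : ℝ[X], Integrable (fun x => q.eval x) (gaussianReal 0 1) :=
    fun q => (hasFiniteMoments_polynomial_gaussianReal q).integrable
  have h1 : ∫ x, p.eval x * (realHermite (l + 1)).eval x ∂gaussianReal 0 1
      = ∫ x, x * (p * realHermite l).eval x ∂gaussianReal 0 1
        - ∫ x, (p * derivative (realHermite l)).eval x ∂gaussianReal 0 1 := by
    rw [← integral_sub _ (hint _)]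
    · congr with x
      rw [realHermite_succ]
      simp
      ring
    · exact integrable_mul_polynomial_gaussianReal _
  have h2 : ∫ x, (derivative p).eval x * (realHermite l).eval x ∂gaussianReal 0 1
      = ∫ x, (derivative (p * realHermite l)).eval x ∂gaussianReal 0 1
        - ∫ x, (p * derivative (realHermite l)).eval x ∂gaussianReal 0 1 := by
    rw [← integral_sub (hint _) (hint _)]
    congr with x
    rw [derivative_mul]
    simp
  rw [h1, h2, h]

/-- Pairing of a shifted Hermite polynomial with a Hermite polynomial. -/
theorem integral_realHermite_shift_mul (c : ℝ) (m l : ℕ) :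
    ∫ x, (realHermite m).eval (c + x) * (realHermite l).eval x ∂gaussianReal 0 1
      = m.descFactorial l * c ^ (m - l) := by
  induction l generalizing m with
  | zero => simp [realHermite_zero, integral_realHermite_shift]
  | succ l ih =>
    have hcomp : ∀ q : ℝ[X], ∀ x, q.eval (c + x) = (q.comp (C c + X)).eval x := by
      intro q x; simp
    have hstep : ∫ x, (realHermite m).eval (c + x) * (realHermite (l + 1)).eval x
          ∂gaussianReal 0 1
        = ∫ x, (derivative (realHermite m)).eval (c + x) * (realHermite l).eval x
          ∂gaussianReal 0 1 := by
      simp only [hcomp]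
      rw [integral_polynomial_mul_realHermite_succ]
      simp [derivative_comp]
    rw [hstep]
    cases m with
    | zero => simp [realHermite_zero]
    | succ m =>
      have heval : ∀ x, (derivative (realHermite (m + 1))).eval (c + x) * (realHermite l).eval x
          = ((m : ℝ) + 1) * ((realHermite m).eval (c + x) * (realHermite l).eval x) := by
        intro x
        rw [derivative_realHermite_succ, eval_mul, eval_add, eval_natCast, eval_one, mul_assoc]
      simp only [heval]
      rw [integral_const_mul, ih, Nat.succ_descFactorial_succ]
      push_cast
      ring

end Hermite

/-! ### Multi-indices -/

section MultiIndex

variable {ι : Type*} [Fintype ι] [DecidableEq ι]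

/-- The multi-indices bounded coordinatewise by `α`. -/
def multiIndexBelow (α : ι → ℕ) : Finset (ι → ℕ) :=
  Fintype.piFinset fun p => Finset.range (α p + 1)

theorem mem_multiIndexBelow {α β : ι → ℕ} : β ∈ multiIndexBelow α ↔ ∀ p, β p ≤ α p := by
  simp [multiIndexBelow]

theorem self_mem_multiIndexBelow (α : ι → ℕ) : α ∈ multiIndexBelow α :=
  mem_multiIndexBelow.2 fun _ => le_rfl

/-- The product of the binomial coefficients `α p` choose `β p`. -/
def multiChoose (α β : ι → ℕ) : ℕ := ∏ p, (α p).choose (β p)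

omit [DecidableEq ι] in
theorem multiChoose_self (α : ι → ℕ) : multiChoose α α = 1 := by simp [multiChoose]

theorem multiChoose_eq_zero {α β : ι → ℕ} (h : β ∉ multiIndexBelow α) : multiChoose α β = 0 := by
  rw [mem_multiIndexBelow] at h
  push Not at h
  obtain ⟨p, hp⟩ := h
  exact Finset.prod_eq_zero (Finset.mem_univ p) (Nat.choose_eq_zero_of_lt hp)

/-- The binomial theorem in each coordinate, multiplied over the coordinates. -/
theorem sum_multiChoose_mul_pow (α : ι → ℕ) (y : ℝ) :
    ∑ β ∈ multiIndexBelow α, (multiChoose α β : ℝ) * y ^ (∑ p, β p) = (y + 1) ^ (∑ p, α p) := by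
  have h := Finset.prod_univ_sum (fun p => Finset.range (α p + 1))
    (fun p b => y ^ b * ((α p).choose b : ℝ))
  have h1 : ∀ p, ∑ b ∈ Finset.range (α p + 1), y ^ b * ((α p).choose b : ℝ)
      = (y + 1) ^ (α p) := by
    intro p
    rw [add_pow]
    simp
  simp only [h1] at h
  rw [← Finset.prod_pow_eq_pow_sum, h]
  refine Finset.sum_congr rfl fun β _ => ?_
  rw [Finset.prod_mul_distrib, Finset.prod_pow_eq_pow_sum, multiChoose]
  push_cast
  ring

/-- The multi-indices of total degree at most `D`. -/
def multiIndexDegLE (ι : Type*) [Fintype ι] [DecidableEq ι] (D : ℕ) : Finset (ι → ℕ) :=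
  (Finset.range (D + 1)).biUnion fun d => Finset.piAntidiag Finset.univ d

theorem mem_multiIndexDegLE {D : ℕ} {α : ι → ℕ} :
    α ∈ multiIndexDegLE ι D ↔ ∑ p, α p ≤ D := by
  simp [multiIndexDegLE]

theorem sum_multiIndexDegLE (D : ℕ) (f : (ι → ℕ) → ℝ) :
    ∑ α ∈ multiIndexDegLE ι D, f α
      = ∑ d ∈ Finset.range (D + 1), ∑ α ∈ Finset.piAntidiag Finset.univ d, f α := by
  refine Finset.sum_biUnion fun a _ b _ hab => ?_
  rw [Function.onFun, Finset.disjoint_left]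
  intro α ha hb
  simp only [Finset.mem_piAntidiag] at ha hb
  exact hab (ha.1.symm.trans hb.1)

theorem sum_lt_of_mem_erase_multiIndexBelow {α β : ι → ℕ}
    (h : β ∈ (multiIndexBelow α).erase α) : ∑ p, β p < ∑ p, α p := by
  rw [Finset.mem_erase, mem_multiIndexBelow] at h
  obtain ⟨hne, hle⟩ := h
  refine Finset.sum_lt_sum (fun p _ => hle p) ?_
  by_contra! hcon
  exact hne (funext fun p => le_antisymm (hle p) (hcon p (Finset.mem_univ p)))

/-- The solution of the moment-cumulant relation
`M α = ∑ β ≤ α, choose α β * κ β * m (α - β)`. -/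
noncomputable def cumulant (m M : (ι → ℕ) → ℝ) (α : ι → ℕ) : ℝ :=
  M α - ∑ β ∈ ((multiIndexBelow α).erase α).attach,
    multiChoose α β.1 * cumulant m M β.1 * m (α - β.1)
termination_by ∑ p, α p
decreasing_by exact sum_lt_of_mem_erase_multiIndexBelow β.2

theorem cumulant_eq (m M : (ι → ℕ) → ℝ) (α : ι → ℕ) :
    cumulant m M α = M α - ∑ β ∈ (multiIndexBelow α).erase α,
      multiChoose α β * cumulant m M β * m (α - β) := by
  rw [cumulant]
  congr 1
  exact Finset.sum_attach _ fun β => multiChoose α β * cumulant m M β * m (α - β)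

theorem sum_cumulant (m M : (ι → ℕ) → ℝ) (hm : m 0 = 1) (α : ι → ℕ) :
    ∑ β ∈ multiIndexBelow α, multiChoose α β * cumulant m M β * m (α - β) = M α := by
  rw [← Finset.add_sum_erase _ _ (self_mem_multiIndexBelow α), cumulant_eq m M α,
    multiChoose_self, tsub_self, hm]
  ring

end MultiIndex

/-! ### The low-degree lower bound for Gaussian additive models -/

section LowDegree

variable {ι : Type*} [Fintype ι] [DecidableEq ι]

/-- Product of Hermite polynomials with multi-index `γ`. -/
noncomputable def hermiteProd (γ : ι → ℕ) (y : ι → ℝ) : ℝ :=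
  ∏ p, (realHermite (γ p)).eval (y p)

/-- Linear combinations of Hermite products of degree at most `D`. -/
noncomputable def hermiteSpan (ι : Type*) [Fintype ι] (D : ℕ) : Submodule ℝ ((ι → ℝ) → ℝ) :=
  Submodule.span ℝ (hermiteProd '' {γ : ι → ℕ | ∑ p, γ p ≤ D})

omit [DecidableEq ι] in
theorem hermiteSpan_mono {D D' : ℕ} (h : D ≤ D') : hermiteSpan ι D ≤ hermiteSpan ι D' :=
  Submodule.span_mono (Set.image_mono fun _ hγ => le_trans hγ h)

omit [DecidableEq ι] in
theorem hermiteProd_mem_hermiteSpan {D : ℕ} {γ : ι → ℕ} (h : ∑ p, γ p ≤ D) :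
    hermiteProd γ ∈ hermiteSpan ι D :=
  Submodule.subset_span ⟨γ, h, rfl⟩

theorem hermiteProd_update (γ : ι → ℕ) (p : ι) (m : ℕ) (y : ι → ℝ) :
    hermiteProd (Function.update γ p m) y
      = (realHermite m).eval (y p) * ∏ r ∈ Finset.univ.erase p, (realHermite (γ r)).eval (y r) := by
  rw [hermiteProd, ← Finset.mul_prod_erase _ _ (Finset.mem_univ p)]
  congr 1
  · simp
  · refine Finset.prod_congr rfl fun r hr => ?_
    rw [Function.update_of_ne (Finset.ne_of_mem_erase hr)]

theorem sum_update_eq (γ : ι → ℕ) (p : ι) (m : ℕ) :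
    ∑ r, Function.update γ p m r = m + ∑ r ∈ Finset.univ.erase p, γ r := by
  rw [← Finset.add_sum_erase _ _ (Finset.mem_univ p)]
  congr 1
  · simp
  · refine Finset.sum_congr rfl fun r hr => ?_
    rw [Function.update_of_ne (Finset.ne_of_mem_erase hr)]

/-- The three-term recurrence `x H_(m+1) = H_(m+2) + (m+1) H_m` in the coordinate `p`; `m = 0` has
no lower term and is treated apart. -/
theorem coord_mul_mem_hermiteSpan {D : ℕ} (p : ι) {F : (ι → ℝ) → ℝ} (hF : F ∈ hermiteSpan ι D) :
    (fun y => y p * F y) ∈ hermiteSpan ι (D + 1) := by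
  induction hF using Submodule.span_induction with
  | zero =>
    simp only [Pi.zero_apply, mul_zero]
    exact (hermiteSpan ι (D + 1)).zero_mem
  | add F G _ _ hF hG =>
    convert (hermiteSpan ι (D + 1)).add_mem hF hG using 1
    ext y
    simp [mul_add]
  | smul c F _ hF =>
    convert (hermiteSpan ι (D + 1)).smul_mem c hF using 1
    ext y
    simp
    ring
  | mem F hF =>
    obtain ⟨γ, hγ, rfl⟩ := hF
    replace hγ : ∑ r, γ r ≤ D := hγ
    rw [← Finset.add_sum_erase _ _ (Finset.mem_univ p)] at hγ
    have hself : hermiteProd γ = hermiteProd (Function.update γ p (γ p)) := by simp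
    rw [hself]
    rcases hm : γ p with _ | m
    · have : (fun y => y p * hermiteProd (Function.update γ p 0) y)
          = hermiteProd (Function.update γ p 1) := by
        ext y
        rw [hermiteProd_update, hermiteProd_update, realHermite_succ, realHermite_zero]
        simp
      rw [this]
      refine hermiteProd_mem_hermiteSpan ?_
      rw [sum_update_eq]
      omega
    · have : (fun y => y p * hermiteProd (Function.update γ p (m + 1)) y)
          = hermiteProd (Function.update γ p (m + 2))
            + ((m : ℝ) + 1) • hermiteProd (Function.update γ p m) := by
        ext y
        rw [Pi.add_apply, Pi.smul_apply, smul_eq_mul]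
        rw [hermiteProd_update, hermiteProd_update, hermiteProd_update]
        have h := congrArg (Polynomial.eval (y p)) (X_mul_realHermite_succ m)
        rw [Polynomial.eval_mul, Polynomial.eval_X, Polynomial.eval_add, Polynomial.eval_mul,
          Polynomial.eval_add, Polynomial.eval_natCast, Polynomial.eval_one] at h
        rw [← mul_assoc, h]
        ring
      rw [this]
      refine Submodule.add_mem _ (hermiteProd_mem_hermiteSpan ?_)
        (Submodule.smul_mem _ _ (hermiteProd_mem_hermiteSpan ?_)) <;>
      · rw [sum_update_eq]
        omega

omit [DecidableEq ι] in
theorem const_mem_hermiteSpan (D : ℕ) (c : ℝ) : (fun _ => c) ∈ hermiteSpan ι D := by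
  have h := (hermiteSpan ι D).smul_mem c
    (hermiteProd_mem_hermiteSpan (γ := (0 : ι → ℕ)) (by simp))
  convert h using 1
  ext y
  simp [hermiteProd, realHermite_zero]

theorem coord_pow_mul_mem_hermiteSpan {D : ℕ} (p : ι) (m : ℕ) {F : (ι → ℝ) → ℝ}
    (hF : F ∈ hermiteSpan ι D) : (fun y => y p ^ m * F y) ∈ hermiteSpan ι (D + m) := by
  induction m with
  | zero => simpa using hF
  | succ m ih =>
    have h : (fun y => y p ^ (m + 1) * F y) = fun y => y p * (y p ^ m * F y) := by
      ext y
      ring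
    rw [h]
    exact coord_mul_mem_hermiteSpan p ih

theorem monomial_mem_hermiteSpan (s : Finset ι) (γ : ι → ℕ) (c : ℝ) :
    (fun y : ι → ℝ => c * ∏ p ∈ s, y p ^ γ p) ∈ hermiteSpan ι (∑ p ∈ s, γ p) := by
  induction s using Finset.induction with
  | empty => simpa using const_mem_hermiteSpan 0 c
  | insert p s hp ih =>
    rw [Finset.sum_insert hp, add_comm]
    convert coord_pow_mul_mem_hermiteSpan p (γ p) ih using 1
    ext y
    rw [Finset.prod_insert hp]
    ring

theorem mvPolynomial_eval_mem_hermiteSpan {D : ℕ} (f : MvPolynomial ι ℝ)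
    (hf : f.totalDegree ≤ D) : (fun y => MvPolynomial.eval y f) ∈ hermiteSpan ι D := by
  have h : (fun y : ι → ℝ => MvPolynomial.eval y f)
      = ∑ d ∈ f.support, fun y => f.coeff d * ∏ p, y p ^ d p := by
    ext y
    rw [MvPolynomial.eval_eq', Finset.sum_apply]
  rw [h]
  refine Submodule.sum_mem _ fun d hd => hermiteSpan_mono ?_ (monomial_mem_hermiteSpan _ _ _)
  refine le_trans ?_ ((MvPolynomial.le_totalDegree hd).trans hf)
  rw [Finsupp.sum_fintype _ _ fun _ => rfl]

/-! ### Hermite orthogonality, the dual certificate and the mean squared error -/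

/-- The standard Gaussian measure on `ι → ℝ`. -/
noncomputable abbrev stdGaussianPi (ι : Type*) [Fintype ι] : Measure (ι → ℝ) :=
  Measure.pi fun _ => gaussianReal 0 1

omit [DecidableEq ι] in
theorem integral_hermiteProd_shift_mul (c : ι → ℝ) (γ β : ι → ℕ) :
    ∫ z, hermiteProd γ (c + z) * hermiteProd β z ∂stdGaussianPi ι
      = (∏ p, ((β p).factorial : ℝ)) * multiChoose γ β * ∏ p, c p ^ (γ p - β p) := by
  simp only [hermiteProd, ← Finset.prod_mul_distrib, Pi.add_apply]
  rw [integral_fintype_prod_eq_prod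
    (f := fun p z => (realHermite (γ p)).eval (c p + z) * (realHermite (β p)).eval z)]
  simp only [integral_realHermite_shift_mul, multiChoose, Nat.descFactorial_eq_factorial_mul_choose]
  push_cast
  rw [Finset.prod_mul_distrib, Finset.prod_mul_distrib]

/-- The case `c = 0` of the shifted pairing: the factor `0 ^ (γ p - β p)` leaves only `γ = β` among
the `β` below `γ`. -/
theorem integral_hermiteProd_mul (γ β : ι → ℕ) :
    ∫ z, hermiteProd γ z * hermiteProd β z ∂stdGaussianPi ι
      = if γ = β then ∏ p, ((β p).factorial : ℝ) else 0 := by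
  have h := integral_hermiteProd_shift_mul 0 γ β
  simp only [zero_add] at h
  rw [h]
  split_ifs with hγ
  · subst hγ
    simp [multiChoose_self]
  · by_cases hβ : β ∈ multiIndexBelow γ
    · rw [mem_multiIndexBelow] at hβ
      have : ∃ p, γ p - β p ≠ 0 := by
        by_contra! hcon
        exact hγ (funext fun p => by have := hβ p; have := hcon p; omega)
      obtain ⟨p, hp⟩ := this
      have h0 : ∏ p, (0 : ι → ℝ) p ^ (γ p - β p) = 0 :=
        Finset.prod_eq_zero (Finset.mem_univ p) (by simp [hp])
      rw [h0, mul_zero]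
    · rw [multiChoose_eq_zero hβ]
      simp

variable {S : Type*} [MeasurableSpace S] {μ : Measure S} [IsProbabilityMeasure μ]

omit [DecidableEq ι] in
theorem hasFiniteMoments_noise (p : ι) :
    HasFiniteMoments (fun w : S × (ι → ℝ) => w.2 p) (μ.prod (stdGaussianPi ι)) :=
  hasFiniteMoments_id_gaussianReal.comp_measurePreserving
    ((measurePreserving_eval (fun _ : ι => gaussianReal 0 1) p).comp measurePreserving_snd)

omit [DecidableEq ι] [IsProbabilityMeasure μ] in
theorem hasFiniteMoments_signal {F : S → ℝ} (hF : HasFiniteMoments F μ) :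
    HasFiniteMoments (fun w : S × (ι → ℝ) => F w.1) (μ.prod (stdGaussianPi ι)) :=
  hF.comp_measurePreserving measurePreserving_fst

omit [DecidableEq ι] in
theorem hasFiniteMoments_hermiteProd_comp {T : Type*} [MeasurableSpace T] {ν : Measure T}
    [IsFiniteMeasure ν] {Y : T → ι → ℝ} (hY : ∀ p, HasFiniteMoments (fun w => Y w p) ν)
    (γ : ι → ℕ) : HasFiniteMoments (fun w => hermiteProd γ (Y w)) ν :=
  HasFiniteMoments.prod _ fun p _ => (hY p).polynomial_eval _

omit [DecidableEq ι] in
theorem hasFiniteMoments_hermiteSpan_comp {T : Type*} [MeasurableSpace T] {ν : Measure T}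
    [IsFiniteMeasure ν] {Y : T → ι → ℝ} (hY : ∀ p, HasFiniteMoments (fun w => Y w p) ν)
    {D : ℕ} {F : (ι → ℝ) → ℝ} (hF : F ∈ hermiteSpan ι D) :
    HasFiniteMoments (fun w => F (Y w)) ν := by
  induction hF using Submodule.span_induction with
  | zero => exact HasFiniteMoments.const 0
  | add F G _ _ hF hG => exact hF.add hG
  | smul c F _ hF => exact (HasFiniteMoments.const c).mul hF
  | mem F hF =>
    obtain ⟨γ, -, rfl⟩ := hF
    exact hasFiniteMoments_hermiteProd_comp hY γ

/-- The dual certificate: the polynomial of the noise with Hermite coefficients `κ β / β!`. -/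
noncomputable def dualCertificate (κ : (ι → ℕ) → ℝ) (D : ℕ) (z : ι → ℝ) : ℝ :=
  ∑ β ∈ multiIndexDegLE ι D, κ β / (∏ p, ((β p).factorial : ℝ)) * hermiteProd β z

omit [DecidableEq ι] in
theorem prod_factorial_ne_zero (β : ι → ℕ) : (∏ p, ((β p).factorial : ℝ)) ≠ 0 :=
  Finset.prod_ne_zero_iff.2 fun p _ => by exact_mod_cast (β p).factorial_ne_zero

theorem hasFiniteMoments_dualCertificate {T : Type*} [MeasurableSpace T] {ν : Measure T}
    [IsFiniteMeasure ν] {Y : T → ι → ℝ} (hY : ∀ p, HasFiniteMoments (fun w => Y w p) ν)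
    (κ : (ι → ℕ) → ℝ) (D : ℕ) : HasFiniteMoments (fun w => dualCertificate κ D (Y w)) ν :=
  HasFiniteMoments.sum _ fun _ _ =>
    (HasFiniteMoments.const _).mul (hasFiniteMoments_hermiteProd_comp hY _)

/-- Parseval: the Hermite products are orthogonal with squared norm `β!`, so the coefficient `κ β /
β!` contributes `κ β² / β!`. -/
theorem integral_dualCertificate_sq (κ : (ι → ℕ) → ℝ) (D : ℕ) :
    ∫ z, dualCertificate κ D z ^ 2 ∂stdGaussianPi ι
      = ∑ β ∈ multiIndexDegLE ι D, κ β ^ 2 / ∏ p, ((β p).factorial : ℝ) := by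
  have hz : ∀ p : ι, HasFiniteMoments (fun z : ι → ℝ => z p) (stdGaussianPi ι) := fun p =>
    hasFiniteMoments_id_gaussianReal.comp_measurePreserving
      (measurePreserving_eval (fun _ : ι => gaussianReal 0 1) p)
  have hexp : ∀ z, dualCertificate κ D z ^ 2
      = ∑ γ ∈ multiIndexDegLE ι D, ∑ β ∈ multiIndexDegLE ι D,
        (κ γ / (∏ p, ((γ p).factorial : ℝ)) * (κ β / (∏ p, ((β p).factorial : ℝ))))
          * (hermiteProd γ z * hermiteProd β z) := by
    intro z
    rw [dualCertificate, sq, Finset.sum_mul_sum]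
    refine Finset.sum_congr rfl fun γ _ => Finset.sum_congr rfl fun β _ => ?_
    ring
  have hint : ∀ γ β : ι → ℕ, Integrable (fun z => hermiteProd γ z * hermiteProd β z)
      (stdGaussianPi ι) := fun γ β =>
    ((hasFiniteMoments_hermiteProd_comp hz γ).mul
      (hasFiniteMoments_hermiteProd_comp hz β)).integrable
  simp only [hexp]
  rw [integral_finsetSum _ fun γ _ => integrable_finsetSum _ fun β _ => (hint γ β).const_mul _]
  refine Finset.sum_congr rfl fun γ hγ => ?_
  rw [integral_finsetSum _ fun β _ => (hint γ β).const_mul _]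
  simp only [integral_const_mul, integral_hermiteProd_mul, mul_ite, mul_zero]
  rw [Finset.sum_ite_eq, if_pos hγ]
  field_simp [prod_factorial_ne_zero γ]

/-- The dual certificate has the same correlations with low-degree polynomials of the data as
the estimand. -/
theorem integral_mul_dualCertificate {ξ : S → ι → ℝ} (hξ : ∀ p, HasFiniteMoments (fun s => ξ s p) μ)
    {x : S → ℝ} (hx : HasFiniteMoments x μ) {κ : (ι → ℕ) → ℝ} {D : ℕ}
    (hκ : ∀ γ, ∑ p, γ p ≤ D → ∑ β ∈ multiIndexBelow γ,
      multiChoose γ β * κ β * ∫ s, ∏ p, ξ s p ^ (γ p - β p) ∂μ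
        = ∫ s, x s * ∏ p, ξ s p ^ γ p ∂μ)
    {F : (ι → ℝ) → ℝ} (hF : F ∈ hermiteSpan ι D) :
    ∫ w, F (ξ w.1 + w.2) * dualCertificate κ D w.2 ∂μ.prod (stdGaussianPi ι)
      = ∫ w, F (ξ w.1 + w.2) * x w.1 ∂μ.prod (stdGaussianPi ι) := by
  have hY : ∀ p, HasFiniteMoments (fun w : S × (ι → ℝ) => (ξ w.1 + w.2) p)
      (μ.prod (stdGaussianPi ι)) := fun p =>
    (hasFiniteMoments_signal (hξ p)).add (hasFiniteMoments_noise p)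
  have hg : HasFiniteMoments (fun w : S × (ι → ℝ) => dualCertificate κ D w.2)
      (μ.prod (stdGaussianPi ι)) :=
    hasFiniteMoments_dualCertificate hasFiniteMoments_noise κ D
  have hx' : HasFiniteMoments (fun w : S × (ι → ℝ) => x w.1) (μ.prod (stdGaussianPi ι)) :=
    hasFiniteMoments_signal hx
  induction hF using Submodule.span_induction with
  | zero => simp
  | add F G hF hG ihF ihG =>
    simp only [Pi.add_apply, add_mul]
    have hF' := hasFiniteMoments_hermiteSpan_comp hY hF
    have hG' := hasFiniteMoments_hermiteSpan_comp hY hG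
    rw [integral_add (hF'.mul hg).integrable (hG'.mul hg).integrable,
      integral_add (hF'.mul hx').integrable (hG'.mul hx').integrable, ihF, ihG]
  | smul c F _ ihF =>
    simp only [Pi.smul_apply, smul_eq_mul, mul_assoc]
    rw [integral_const_mul, integral_const_mul, ihF]
  | mem F hF =>
    obtain ⟨γ, hγ, rfl⟩ := hF
    replace hγ : ∑ r, γ r ≤ D := hγ
    have hH := hasFiniteMoments_hermiteProd_comp hY γ
    have hR : ∫ w, hermiteProd γ (ξ w.1 + w.2) * x w.1 ∂μ.prod (stdGaussianPi ι)
        = ∫ s, x s * ∏ p, ξ s p ^ γ p ∂μ := by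
      rw [integral_prod _ (hH.mul hx').integrable]
      congr with s
      simp only
      rw [integral_mul_const, mul_comm]
      have h := integral_hermiteProd_shift_mul (ξ s) γ 0
      simp only [multiChoose, Pi.zero_apply, Nat.choose_zero_right, tsub_zero,
        Nat.factorial_zero, Nat.cast_one, Finset.prod_const_one, one_mul] at h
      rw [← h]
      congr with z
      simp [hermiteProd, realHermite_zero]
    have hpair : ∀ β : ι → ℕ,
        ∫ w, hermiteProd γ (ξ w.1 + w.2) * hermiteProd β w.2 ∂μ.prod (stdGaussianPi ι)
          = (∏ p, ((β p).factorial : ℝ)) * multiChoose γ β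
            * ∫ s, ∏ p, ξ s p ^ (γ p - β p) ∂μ := by
      intro β
      rw [integral_prod _
        (hH.mul (hasFiniteMoments_hermiteProd_comp hasFiniteMoments_noise β)).integrable]
      simp only [integral_hermiteProd_shift_mul]
      rw [integral_const_mul]
    rw [hR, ← hκ γ hγ]
    simp only [dualCertificate, Finset.mul_sum]
    rw [integral_finsetSum _ fun β _ => (hH.mul ((HasFiniteMoments.const _).mul
      (hasFiniteMoments_hermiteProd_comp hasFiniteMoments_noise β))).integrable]
    simp only [mul_left_comm]
    simp only [integral_const_mul, hpair]
    -- Only `β ≤ γ` pairs nontrivially with the shifted `H_γ`, and all such `β` have degree at most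
    -- `D`. The `β!` of the pairing cancels the one in the certificate, leaving the left side of
    -- `hκ`.
    rw [← Finset.sum_subset (s₁ := multiIndexBelow γ)]
    · refine Finset.sum_congr rfl fun β _ => ?_
      field_simp [prod_factorial_ne_zero β]
    · intro β hβ
      rw [mem_multiIndexBelow] at hβ
      exact mem_multiIndexDegLE.2 ((Finset.sum_le_sum fun p _ => hβ p).trans hγ)
    · intro β _ hβ
      rw [multiChoose_eq_zero hβ]
      simp

/-- Lower bound on the mean squared error of low-degree polynomial estimators in a Gaussian
additive model in terms of cumulants. -/
theorem le_integral_sq_sub {ξ : S → ι → ℝ} (hξ : ∀ p, HasFiniteMoments (fun s => ξ s p) μ)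
    {x : S → ℝ} (hx : HasFiniteMoments x μ) {κ : (ι → ℕ) → ℝ} {D : ℕ}
    (hκ : ∀ γ, ∑ p, γ p ≤ D → ∑ β ∈ multiIndexBelow γ,
      multiChoose γ β * κ β * ∫ s, ∏ p, ξ s p ^ (γ p - β p) ∂μ
        = ∫ s, x s * ∏ p, ξ s p ^ γ p ∂μ)
    {F : (ι → ℝ) → ℝ} (hF : F ∈ hermiteSpan ι D) :
    ∫ s, x s ^ 2 ∂μ - ∑ β ∈ multiIndexDegLE ι D, κ β ^ 2 / ∏ p, ((β p).factorial : ℝ)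
      ≤ ∫ w, (F (ξ w.1 + w.2) - x w.1) ^ 2 ∂μ.prod (stdGaussianPi ι) := by
  have hY : ∀ p, HasFiniteMoments (fun w : S × (ι → ℝ) => (ξ w.1 + w.2) p)
      (μ.prod (stdGaussianPi ι)) := fun p =>
    (hasFiniteMoments_signal (hξ p)).add (hasFiniteMoments_noise p)
  have hg : HasFiniteMoments (fun w : S × (ι → ℝ) => dualCertificate κ D w.2)
      (μ.prod (stdGaussianPi ι)) :=
    hasFiniteMoments_dualCertificate hasFiniteMoments_noise κ D
  have hx' : HasFiniteMoments (fun w : S × (ι → ℝ) => x w.1) (μ.prod (stdGaussianPi ι)) :=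
    hasFiniteMoments_signal hx
  have hF' := hasFiniteMoments_hermiteSpan_comp hY hF
  have hdual := integral_mul_dualCertificate hξ hx hκ hF
  have hgsq : ∫ w, dualCertificate κ D w.2 ^ 2 ∂μ.prod (stdGaussianPi ι)
      = ∑ β ∈ multiIndexDegLE ι D, κ β ^ 2 / ∏ p, ((β p).factorial : ℝ) := by
    rw [← integral_dualCertificate_sq, integral_prod _ (hg.pow 2).integrable]
    simp
  have hxsq : ∫ w, x w.1 ^ 2 ∂μ.prod (stdGaussianPi ι) = ∫ s, x s ^ 2 ∂μ := by
    rw [integral_prod _ (hx'.pow 2).integrable]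
    simp
  -- Since `F` has the same correlation with the certificate `g` as with `x`, this square bounds `E
  -- F² - 2 E[F x]` below by `-E g²`.
  have hnonneg : 0 ≤ ∫ w, (F (ξ w.1 + w.2) - dualCertificate κ D w.2) ^ 2
      ∂μ.prod (stdGaussianPi ι) := integral_nonneg fun _ => sq_nonneg _
  have hexpand : ∀ G : S × (ι → ℝ) → ℝ, HasFiniteMoments G (μ.prod (stdGaussianPi ι)) →
      ∫ w, (F (ξ w.1 + w.2) - G w) ^ 2 ∂μ.prod (stdGaussianPi ι)
        = ∫ w, F (ξ w.1 + w.2) ^ 2 ∂μ.prod (stdGaussianPi ι)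
          - 2 * ∫ w, F (ξ w.1 + w.2) * G w ∂μ.prod (stdGaussianPi ι)
          + ∫ w, G w ^ 2 ∂μ.prod (stdGaussianPi ι) := by
    intro G hG
    rw [← integral_const_mul, ← integral_sub (hF'.pow 2).integrable
      ((hF'.mul hG).integrable.const_mul 2), ← integral_add
      ((hF'.pow 2).sub ((HasFiniteMoments.const 2).mul (hF'.mul hG))).integrable
      (hG.pow 2).integrable]
    congr with w
    ring
  rw [hexpand _ hg] at hnonneg
  rw [hexpand _ hx', ← hdual, hxsq]
  linarith

end LowDegree

/-! ### Moments of the latent position model -/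

section LatentMoments

/-- The uniform distribution on the unit interval. -/
noncomputable def unifUnit : Measure ℝ := volume.restrict (Set.Icc 0 1)

instance : IsProbabilityMeasure unifUnit := ⟨by simp [unifUnit]⟩

variable {N : Type*} [Fintype N] [DecidableEq N] {lam t : ℝ}

/-- The law of independent uniform positions. -/
noncomputable abbrev unifPi (N : Type*) [Fintype N] : Measure (N → ℝ) :=
  Measure.pi fun _ => unifUnit

theorem measurable_bandFunction (lam t : ℝ) : Measurable (bandFunction lam t) := by
  unfold bandFunction
  refine Measurable.const_mul (measurable_const.indicator ?_) _
  exact measurableSet_le measurable_id.abs measurable_const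

theorem bandFunction_of_le {x : ℝ} (h : |x| ≤ t) : bandFunction lam t x = lam := by
  simp [bandFunction, h]

theorem bandFunction_of_not_le {x : ℝ} (h : ¬ |x| ≤ t) : bandFunction lam t x = 0 := by
  simp [bandFunction, h]

theorem bandFunction_nonneg (hlam : 0 ≤ lam) (x : ℝ) : 0 ≤ bandFunction lam t x := by
  by_cases h : |x| ≤ t
  · rwa [bandFunction_of_le h]
  · rw [bandFunction_of_not_le h]

theorem abs_bandFunction_le (x : ℝ) : |bandFunction lam t x| ≤ |lam| := by
  by_cases h : |x| ≤ t
  · rw [bandFunction_of_le h]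
  · simp [bandFunction_of_not_le h]

/-- The entry `p` of the signal as a function of the latent positions. -/
noncomputable def bandEntry (lam t : ℝ) (v : N → ℝ) (p : N × N) : ℝ :=
  bandFunction lam t (v p.1 - v p.2)

omit [Fintype N] [DecidableEq N] in
theorem measurable_bandEntry (lam t : ℝ) (p : N × N) :
    Measurable fun v : N → ℝ => bandEntry lam t v p :=
  (measurable_bandFunction lam t).comp
    ((measurable_pi_apply p.1).sub (measurable_pi_apply p.2))

omit [DecidableEq N] in
theorem hasFiniteMoments_bandEntry (lam t : ℝ) (p : N × N) :
    HasFiniteMoments (fun v => bandEntry lam t v p) (unifPi N) :=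
  HasFiniteMoments.of_bound (measurable_bandEntry lam t p).aestronglyMeasurable |lam|
    fun _ => abs_bandFunction_le _

/-- The mixed moments of the entries of the signal. -/
noncomputable def bandMoment (lam t : ℝ) (α : N × N → ℕ) : ℝ :=
  ∫ v, ∏ p, bandEntry lam t v p ^ α p ∂unifPi N

omit [DecidableEq N] in
theorem bandMoment_zero : bandMoment lam t (0 : N × N → ℕ) = 1 := by
  simp [bandMoment]

omit [DecidableEq N] in
theorem bandMoment_nonneg (hlam : 0 ≤ lam) (α : N × N → ℕ) : 0 ≤ bandMoment lam t α :=
  integral_nonneg fun _ => Finset.prod_nonneg fun _ _ => pow_nonneg (bandFunction_nonneg hlam _) _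

/-- The positions for which all the edges of `α` inside `W` are short. -/
def closeSet (t : ℝ) (α : N × N → ℕ) (W : Finset N) : Set (N → ℝ) :=
  {v | ∀ p : N × N, α p ≠ 0 → p.1 ∈ W → p.2 ∈ W → |v p.1 - v p.2| ≤ t}

omit [DecidableEq N] in
theorem measurableSet_closeSet (t : ℝ) (α : N × N → ℕ) (W : Finset N) :
    MeasurableSet (closeSet t α W) := by
  simp only [closeSet, Set.ofPred_forall]
  refine MeasurableSet.iInter fun p => MeasurableSet.iInter fun _ => MeasurableSet.iInter fun _ =>
    MeasurableSet.iInter fun _ => measurableSet_le ?_ measurable_const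
  exact ((measurable_pi_apply p.1).sub (measurable_pi_apply p.2)).abs

omit [DecidableEq N] in
-- An edge of `α` longer than `t` makes the product vanish; otherwise each factor is at most `lam`.
-- Edges leaving `W` are simply ignored.
theorem bandMoment_le_closeSet (hlam : 0 ≤ lam) (α : N × N → ℕ) (W : Finset N) :
    bandMoment lam t α ≤ lam ^ (∑ p, α p) * (unifPi N).real (closeSet t α W) := by
  have h : ∀ v : N → ℝ, ∏ p, bandEntry lam t v p ^ α p
      ≤ lam ^ (∑ p, α p) * (closeSet t α W).indicator (fun _ => (1 : ℝ)) v := by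
    intro v
    by_cases hv : v ∈ closeSet t α W
    · rw [Set.indicator_of_mem hv, mul_one, ← Finset.prod_pow_eq_pow_sum]
      refine Finset.prod_le_prod (fun p _ => pow_nonneg (bandFunction_nonneg hlam _) _) fun p _ => ?_
      refine pow_le_pow_left₀ (bandFunction_nonneg hlam _) ?_ _
      exact (le_abs_self _).trans ((abs_bandFunction_le _).trans (abs_of_nonneg hlam).le)
    · rw [Set.indicator_of_notMem hv, mul_zero]
      simp only [closeSet, Set.mem_ofPred_eq, not_forall] at hv
      obtain ⟨p, hp, -, -, hfar⟩ := hv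
      refine (Finset.prod_eq_zero (Finset.mem_univ p) ?_).le
      rw [bandEntry, bandFunction_of_not_le hfar, zero_pow hp]
  calc bandMoment lam t α
      ≤ ∫ v, lam ^ (∑ p, α p) * (closeSet t α W).indicator (fun _ => (1 : ℝ)) v ∂unifPi N := by
        refine integral_mono ?_ ?_ h
        · exact (HasFiniteMoments.prod _ fun p _ =>
            (hasFiniteMoments_bandEntry lam t p).pow (α p)).integrable
        · exact ((integrable_const (1 : ℝ)).indicator (measurableSet_closeSet t α W)).const_mul _
    _ = _ := by
        rw [integral_const_mul, integral_indicator_const _ (measurableSet_closeSet t α W)]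
        simp

/-! ### Probabilities that uniform positions are close -/

theorem unifUnit_near_le (t x : ℝ) : unifUnit {y | |x - y| ≤ t} ≤ ENNReal.ofReal (2 * t) := by
  have h : {y | |x - y| ≤ t} = Set.Icc (x - t) (x + t) := by
    ext y
    simp only [Set.mem_ofPred_eq, abs_le, Set.mem_Icc]
    constructor <;> rintro ⟨h1, h2⟩ <;> constructor <;> linarith
  rw [h]
  refine (Measure.restrict_apply_le _ _).trans ?_
  rw [Real.volume_Icc]
  exact ENNReal.ofReal_le_ofReal (by linarith)

theorem le_unifUnit_near {t x : ℝ} (hx : x ∈ Set.Icc t (1 - t)) :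
    ENNReal.ofReal (2 * t) ≤ unifUnit {y | |x - y| ≤ t} := by
  have h : Set.Icc (x - t) (x + t) ⊆ {y | |x - y| ≤ t} ∩ Set.Icc 0 1 := by
    intro y hy
    simp only [Set.mem_Icc, Set.mem_inter_iff, Set.mem_ofPred_eq, abs_le] at hx hy ⊢
    refine ⟨⟨?_, ?_⟩, ?_, ?_⟩ <;> linarith [hx.1, hx.2, hy.1, hy.2]
  have hm : MeasurableSet {y | |x - y| ≤ t} :=
    measurableSet_le (measurable_const.sub measurable_id).abs measurable_const
  rw [unifUnit, Measure.restrict_apply hm]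
  refine le_trans ?_ (measure_mono h)
  rw [Real.volume_Icc]
  exact ENNReal.ofReal_le_ofReal (by linarith)

/-- Integrate over `v b` first: `A` does not depend on it, and given `v a` it must fall in an
interval of length `2t`. This is one step of the graph exploration. -/
theorem unifPi_inter_near_le {a b : N} (hab : a ≠ b) {A : Set (N → ℝ)} (hA : MeasurableSet A)
    (hinv : ∀ v y, Function.update v b y ∈ A ↔ v ∈ A) (t : ℝ) :
    unifPi N (A ∩ {v | |v a - v b| ≤ t}) ≤ ENNReal.ofReal (2 * t) * unifPi N A := by
  have hB : MeasurableSet {v : N → ℝ | |v a - v b| ≤ t} :=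
    measurableSet_le ((measurable_pi_apply a).sub (measurable_pi_apply b)).abs measurable_const
  rw [← lintegral_indicator_one (hA.inter hB), ← lintegral_indicator_one hA,
    ← lintegral_const_mul _ (measurable_one.indicator hA)]
  refine lintegral_le_of_lmarginal_le {b} (measurable_one.indicator (hA.inter hB))
    ((measurable_one.indicator hA).const_mul _) fun v => ?_
  simp only [lmarginal_singleton]
  by_cases hv : v ∈ A
  · have h1 : ∀ y, (A ∩ {v | |v a - v b| ≤ t}).indicator (1 : (N → ℝ) → ENNReal)
        (Function.update v b y) = {y | |v a - y| ≤ t}.indicator 1 y := by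
      intro y
      have hmem : Function.update v b y ∈ A ∩ {v | |v a - v b| ≤ t} ↔ y ∈ {y | |v a - y| ≤ t} := by
        rw [Set.mem_inter_iff, hinv]
        simp [hv, Function.update_of_ne hab]
      by_cases hy : y ∈ {y | |v a - y| ≤ t}
      · rw [Set.indicator_of_mem (hmem.2 hy), Set.indicator_of_mem hy]
        rfl
      · rw [Set.indicator_of_notMem (fun h => hy (hmem.1 h)), Set.indicator_of_notMem hy]
    have hm : MeasurableSet {y | |v a - y| ≤ t} :=
      measurableSet_le (measurable_const.sub measurable_id).abs measurable_const
    simp only [h1]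
    rw [lintegral_indicator_one hm]
    refine (unifUnit_near_le t (v a)).trans ?_
    simp [hinv, hv]
  · simp [hinv, hv]

/-- When `v a` is at distance at least `t` from both ends of the unit interval, the whole interval
of length `2t` around it is available to `v b`. That event has probability at least `1 - 2t`, so the
boundary costs at most `4t²`. -/
theorem le_unifPi_near {a b : N} (hab : a ≠ b) {t : ℝ} (ht0 : 0 ≤ t) :
    2 * t - 4 * t ^ 2 ≤ (unifPi N).real {v | |v a - v b| ≤ t} := by
  have hB : MeasurableSet {v : N → ℝ | |v a - v b| ≤ t} :=
    measurableSet_le ((measurable_pi_apply a).sub (measurable_pi_apply b)).abs measurable_const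
  have hA : MeasurableSet {v : N → ℝ | v a ∈ Set.Icc t (1 - t)} :=
    measurable_pi_apply a measurableSet_Icc
  have h1 : ENNReal.ofReal (2 * t) * unifPi N {v | v a ∈ Set.Icc t (1 - t)}
      ≤ unifPi N {v | |v a - v b| ≤ t} := by
    rw [← lintegral_indicator_one hB, ← lintegral_indicator_one hA,
      ← lintegral_const_mul _ (measurable_one.indicator hA)]
    refine lintegral_le_of_lmarginal_le {b} ((measurable_one.indicator hA).const_mul _)
      (measurable_one.indicator hB) fun v => ?_
    simp only [lmarginal_singleton]
    have h1 : ∀ y, {v | |v a - v b| ≤ t}.indicator (1 : (N → ℝ) → ENNReal)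
        (Function.update v b y) = {y | |v a - y| ≤ t}.indicator 1 y := by
      intro y
      simp [Set.indicator_apply, Function.update_of_ne hab]
    have hm : MeasurableSet {y | |v a - y| ≤ t} :=
      measurableSet_le (measurable_const.sub measurable_id).abs measurable_const
    simp only [h1]
    rw [lintegral_indicator_one hm]
    by_cases hv : v a ∈ Set.Icc t (1 - t)
    · refine le_trans ?_ (le_unifUnit_near hv)
      simp only [Set.mem_Icc] at hv
      simp [Function.update_of_ne hab, hv]
    · simp only [Set.mem_Icc] at hv
      simp [Function.update_of_ne hab, hv]
  have h2 : unifPi N {v | v a ∈ Set.Icc t (1 - t)} = ENNReal.ofReal (1 - 2 * t) := by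
    have := (measurePreserving_eval (fun _ : N => unifUnit) a).measure_preimage
      (measurableSet_Icc (a := t) (b := 1 - t)).nullMeasurableSet
    have hset : {v : N → ℝ | v a ∈ Set.Icc t (1 - t)}
        = Function.eval a ⁻¹' Set.Icc t (1 - t) := rfl
    rw [hset, this, unifUnit, Measure.restrict_apply measurableSet_Icc,
      Set.inter_eq_left.2 (Set.Icc_subset_Icc ht0 (by linarith)), Real.volume_Icc]
    congr 1
    ring
  rw [h2, ← ENNReal.ofReal_mul (by linarith)] at h1
  have h3 := (ENNReal.ofReal_le_iff_le_toReal (measure_ne_top _ _)).1 h1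
  rw [measureReal_def]
  linarith

/-- If `U` is reachable from `W` along edges of `α`, all these edges are simultaneously short with
probability at most `(2 t) ^ (|U| - |W|)`. -/
theorem unifPi_closeSet_le {α : N × N → ℕ} {W U : Finset N} (hWU : W ⊆ U)
    (hgrow : ∀ W', W ⊆ W' → W' ⊂ U → ∃ a ∈ W', ∃ b ∈ U, b ∉ W' ∧ (α (a, b) ≠ 0 ∨ α (b, a) ≠ 0)) :
    unifPi N (closeSet t α U) ≤ ENNReal.ofReal (2 * t) ^ (U.card - W.card) := by
  have key : ∀ m, W.card + m ≤ U.card → ∃ W', W ⊆ W' ∧ W' ⊆ U ∧ W'.card = W.card + m ∧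
      unifPi N (closeSet t α W') ≤ ENNReal.ofReal (2 * t) ^ m := by
    intro m
    induction m with
    | zero => exact fun _ => ⟨W, subset_rfl, hWU, rfl, by simpa using prob_le_one⟩
    | succ m ih =>
      intro hm
      obtain ⟨W', hWW', hW'U, hcard, hle⟩ := ih (by omega)
      obtain ⟨a, ha, b, hbU, hb, hedge⟩ := hgrow W' hWW' (hW'U.ssubset_of_ne (by
        rintro rfl; omega))
      refine ⟨insert b W', hWW'.trans (Finset.subset_insert _ _),
        Finset.insert_subset hbU hW'U, by rw [Finset.card_insert_of_notMem hb]; omega, ?_⟩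
      have hab : a ≠ b := by rintro rfl; exact hb ha
      -- Of all the edges that `b` brings in, only one joining it to `a` is kept. The constraints
      -- inside `W'` do not involve `v b`, so this edge costs one factor `2t`.
      have hsub : closeSet t α (insert b W') ⊆ closeSet t α W' ∩ {v | |v a - v b| ≤ t} := by
        intro v hv
        refine ⟨fun p hp h1 h2 => hv p hp (Finset.mem_insert_of_mem h1)
          (Finset.mem_insert_of_mem h2), ?_⟩
        rcases hedge with h | h
        · exact hv _ h (Finset.mem_insert_of_mem ha) (Finset.mem_insert_self _ _)
        · have := hv _ h (Finset.mem_insert_self _ _) (Finset.mem_insert_of_mem ha)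
          rwa [abs_sub_comm] at this
      refine (measure_mono hsub).trans ((unifPi_inter_near_le hab (measurableSet_closeSet _ _ _)
        ?_ t).trans ?_)
      · intro v y
        simp only [closeSet, Set.mem_ofPred_eq]
        refine forall_congr' fun p => imp_congr_right fun _ => imp_congr_ctx Iff.rfl fun h1 =>
          imp_congr_ctx Iff.rfl fun h2 => ?_
        rw [Function.update_of_ne (by rintro h; exact hb (h ▸ h1)),
          Function.update_of_ne (by rintro h; exact hb (h ▸ h2))]
      · rw [pow_succ, mul_comm]
        gcongr
  obtain ⟨W', -, hW'U, hcard, hle⟩ := key (U.card - W.card)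
    (by have := Finset.card_le_card hWU; omega)
  have : W' = U := Finset.eq_of_subset_of_card_le hW'U
    (by have := Finset.card_le_card hWU; omega)
  rwa [this] at hle

theorem bandMoment_le (hlam : 0 ≤ lam) (ht : 0 ≤ t) {α : N × N → ℕ} {W U : Finset N} (hWU : W ⊆ U)
    (hgrow : ∀ W', W ⊆ W' → W' ⊂ U → ∃ a ∈ W', ∃ b ∈ U, b ∉ W' ∧ (α (a, b) ≠ 0 ∨ α (b, a) ≠ 0)) :
    bandMoment lam t α ≤ lam ^ (∑ p, α p) * (2 * t) ^ (U.card - W.card) := by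
  refine (bandMoment_le_closeSet hlam α U).trans ?_
  refine mul_le_mul_of_nonneg_left ?_ (pow_nonneg hlam _)
  have h := unifPi_closeSet_le (t := t) hWU hgrow
  rw [← ENNReal.ofReal_pow (by linarith)] at h
  exact ENNReal.toReal_le_of_le_ofReal (by positivity) h

/-- Moments factorize over edge sets with disjoint vertex sets. -/
theorem bandMoment_add {α β : N × N → ℕ} {W : Finset N}
    (hα : ∀ p, α p ≠ 0 → p.1 ∈ W ∧ p.2 ∈ W) (hβ : ∀ p, β p ≠ 0 → p.1 ∉ W ∧ p.2 ∉ W) :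
    bandMoment lam t (α + β) = bandMoment lam t α * bandMoment lam t β := by
  have hind : iIndepFun (fun (a : N) (v : N → ℝ) => v a) (unifPi N) :=
    iIndepFun_pi (X := fun _ x => x) fun _ => aemeasurable_id
  have hpair := hind.indepFun_finset W Wᶜ disjoint_compl_right fun a => measurable_pi_apply a
  -- Extension by zero exhibits a product over edges inside `W` as a measurable function of the
  -- coordinates in `W`, so independence of disjoint coordinate blocks applies.
  let ext (W : Finset N) (u : W → ℝ) (a : N) : ℝ := if h : a ∈ W then u ⟨a, h⟩ else 0
  have hext : ∀ W : Finset N, Measurable (ext W) := by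
    intro W
    refine measurable_pi_lambda _ fun a => ?_
    by_cases h : a ∈ W
    · simpa only [ext, h, dite_true] using measurable_pi_apply _
    · simpa only [ext, h, dite_false] using measurable_const
  let G (γ : N × N → ℕ) (v : N → ℝ) : ℝ := ∏ p, bandEntry lam t v p ^ γ p
  have hG : ∀ γ, Measurable (G γ) := fun γ =>
    Finset.measurable_prod _ fun p _ => (measurable_bandEntry lam t p).pow_const _
  have hloc : ∀ (W : Finset N) (γ : N × N → ℕ), (∀ p, γ p ≠ 0 → p.1 ∈ W ∧ p.2 ∈ W) →
      ∀ v : N → ℝ, G γ v = G γ (ext W fun a => v a) := by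
    intro W γ hγ v
    refine Finset.prod_congr rfl fun p _ => ?_
    by_cases hp : γ p = 0
    · simp [hp]
    · obtain ⟨h1, h2⟩ := hγ p hp
      simp [bandEntry, ext, h1, h2]
  have hGind : IndepFun (fun v => G α v) (fun v => G β v) (unifPi N) := by
    have h := hpair.comp ((hG α).comp (hext W)) ((hG β).comp (hext Wᶜ))
    convert h using 1
    · ext v; exact hloc W α hα v
    · ext v; exact hloc Wᶜ β (fun p hp => by simpa using hβ p hp) v
  have hmul := hGind.integral_fun_mul_eq_mul_integral (hG α).aestronglyMeasurable
    (hG β).aestronglyMeasurable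
  rw [bandMoment, bandMoment, bandMoment, ← hmul]
  congr with v
  simp only [G, ← Finset.prod_mul_distrib, Pi.add_apply, pow_add]

end LatentMoments

/-! ### Cumulants of the latent position model -/

section Cumulants

variable {N : Type*} [Fintype N] [DecidableEq N] {lam t : ℝ}

/-- The endpoints of `e` and of the edges of the multigraph `α`. -/
def vertexSet (e : N × N) (α : N × N → ℕ) : Finset N :=
  Finset.univ.filter fun a => a = e.1 ∨ a = e.2 ∨ ∃ p, α p ≠ 0 ∧ (p.1 = a ∨ p.2 = a)

theorem mem_vertexSet {e : N × N} {α : N × N → ℕ} {a : N} :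
    a ∈ vertexSet e α ↔ a = e.1 ∨ a = e.2 ∨ ∃ p, α p ≠ 0 ∧ (p.1 = a ∨ p.2 = a) := by
  simp [vertexSet]

theorem fst_mem_vertexSet (e : N × N) (α : N × N → ℕ) : e.1 ∈ vertexSet e α :=
  mem_vertexSet.2 (Or.inl rfl)

theorem snd_mem_vertexSet (e : N × N) (α : N × N → ℕ) : e.2 ∈ vertexSet e α :=
  mem_vertexSet.2 (Or.inr (Or.inl rfl))

theorem endpoints_mem_vertexSet (e : N × N) {α : N × N → ℕ} {p : N × N} (hp : α p ≠ 0) :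
    p.1 ∈ vertexSet e α ∧ p.2 ∈ vertexSet e α :=
  ⟨mem_vertexSet.2 (Or.inr (Or.inr ⟨p, hp, Or.inl rfl⟩)),
    mem_vertexSet.2 (Or.inr (Or.inr ⟨p, hp, Or.inr rfl⟩))⟩

theorem vertexSet_mono (e : N × N) {α β : N × N → ℕ} (h : ∀ p, β p ≤ α p) :
    vertexSet e β ⊆ vertexSet e α := by
  intro a ha
  rw [mem_vertexSet] at ha ⊢
  refine ha.imp_right (Or.imp_right ?_)
  rintro ⟨p, hp, hpa⟩
  exact ⟨p, by have := h p; omega, hpa⟩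

theorem card_vertexSet_le (e : N × N) (α : N × N → ℕ) :
    (vertexSet e α).card ≤ 2 * ∑ p, α p + 2 := by
  have hsub : vertexSet e α ⊆ {e.1, e.2} ∪
      (Finset.univ.filter fun p => α p ≠ 0).biUnion fun p => {p.1, p.2} := by
    intro a ha
    rw [mem_vertexSet] at ha
    simp only [Finset.mem_union, Finset.mem_insert, Finset.mem_singleton, Finset.mem_biUnion,
      Finset.mem_filter, Finset.mem_univ, true_and]
    rcases ha with h | h | ⟨p, hp, h⟩
    · exact Or.inl (Or.inl h)
    · exact Or.inl (Or.inr h)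
    · exact Or.inr ⟨p, hp, h.imp Eq.symm Eq.symm⟩
  have h1 : (Finset.univ.filter fun p => α p ≠ 0).card ≤ ∑ p, α p := by
    rw [Finset.card_eq_sum_ones, Finset.sum_filter]
    refine Finset.sum_le_sum fun p _ => ?_
    split_ifs <;> omega
  have h2 : ((Finset.univ.filter fun p => α p ≠ 0).biUnion fun p => {p.1, p.2}).card
      ≤ (Finset.univ.filter fun p => α p ≠ 0).card * 2 :=
    Finset.card_biUnion_le_card_mul _ _ _ fun p _ => Finset.card_le_two
  have h3 : ({e.1, e.2} : Finset N).card ≤ 2 := Finset.card_le_two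
  have h4 := (Finset.card_le_card hsub).trans (Finset.card_union_le _ _)
  omega

/-- Every edge of `α` is connected to the edge `e`: a vertex set that contains the endpoints of
`e` and is not crossed by `α` contains all edges of `α`. -/
def ConnectedTo (e : N × N) (α : N × N → ℕ) : Prop :=
  ∀ W : Finset N, e.1 ∈ W → e.2 ∈ W → (∀ p, α p ≠ 0 → (p.1 ∈ W ↔ p.2 ∈ W)) →
    ∀ p, α p ≠ 0 → p.1 ∈ W

/-- If no edge of `α` crossed `W`, the cut form of connectedness would put every vertex in `W`. This
feeds the growth hypothesis of `bandMoment_le`. -/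
theorem ConnectedTo.exists_crossing {e : N × N} {α : N × N → ℕ} (h : ConnectedTo e α)
    {W : Finset N} (h1 : e.1 ∈ W) (h2 : e.2 ∈ W) (hW : W ⊂ vertexSet e α) :
    ∃ a ∈ W, ∃ b ∈ vertexSet e α, b ∉ W ∧ (α (a, b) ≠ 0 ∨ α (b, a) ≠ 0) := by
  by_contra! hcon
  have hcross : ∀ p, α p ≠ 0 → (p.1 ∈ W ↔ p.2 ∈ W) := by
    intro p hp
    obtain ⟨hp1, hp2⟩ := endpoints_mem_vertexSet e hp
    constructor
    · intro hin
      by_contra hout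
      exact hp (hcon p.1 hin p.2 hp2 hout).1
    · intro hin
      by_contra hout
      exact hp (hcon p.2 hin p.1 hp1 hout).2
  refine hW.2 fun a ha => ?_
  rw [mem_vertexSet] at ha
  rcases ha with rfl | rfl | ⟨p, hp, rfl | rfl⟩
  · exact h1
  · exact h2
  · exact h W h1 h2 hcross p hp
  · exact (hcross p hp).1 (h W h1 h2 hcross p hp)

/-- The joint cumulants of the entry `e` of the signal with the other entries. -/
noncomputable def bandCumulant (lam t : ℝ) (e : N × N) : (N × N → ℕ) → ℝ :=
  cumulant (bandMoment lam t) fun α => bandMoment lam t (α + Pi.single e 1)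

theorem sum_bandCumulant (e : N × N) (α : N × N → ℕ) :
    ∑ β ∈ multiIndexBelow α, multiChoose α β * bandCumulant lam t e β * bandMoment lam t (α - β)
      = bandMoment lam t (α + Pi.single e 1) :=
  sum_cumulant _ _ bandMoment_zero α

/-- A cut `W` separates `α` into a part `α₁` on the side of `e` and a nonzero part `α₂` outside. The
moment of `α + e` factors, and the recursion at `α₁`, multiplied by the moment of `α₂`, already
accounts for the whole recursion at `α`; nothing is left for `κ α`. -/
theorem bandCumulant_eq_zero (e : N × N) {α : N × N → ℕ} (h : ¬ ConnectedTo e α) :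
    bandCumulant lam t e α = 0 := by
  induction hd : ∑ p, α p using Nat.strong_induction_on generalizing α with
  | _ d ih =>
  subst hd
  have hα := h
  simp only [ConnectedTo, not_forall] at h
  obtain ⟨W, h1, h2, hcross, p₀, hp₀, hp₀W⟩ := h
  let α₁ : N × N → ℕ := fun p => if p.1 ∈ W then α p else 0
  let α₂ : N × N → ℕ := fun p => if p.1 ∈ W then 0 else α p
  have hsplit : α = α₁ + α₂ := by
    ext p
    simp only [α₁, α₂, Pi.add_apply]
    split_ifs <;> simp
  have hα₁ : ∀ p, α₁ p ≠ 0 → p.1 ∈ W ∧ p.2 ∈ W := by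
    intro p hp
    simp only [α₁, ne_eq, ite_eq_right_iff, Classical.not_imp] at hp
    exact ⟨hp.1, (hcross p hp.2).1 hp.1⟩
  have hα₂ : ∀ p, α₂ p ≠ 0 → p.1 ∉ W ∧ p.2 ∉ W := by
    intro p hp
    simp only [α₂, ne_eq, ite_eq_left_iff, Classical.not_imp] at hp
    exact ⟨hp.1, fun h => hp.1 ((hcross p hp.2).2 h)⟩
  have hsub : multiIndexBelow α₁ ⊆ (multiIndexBelow α).erase α := by
    intro β hβ
    rw [mem_multiIndexBelow] at hβ
    rw [Finset.mem_erase, mem_multiIndexBelow]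
    constructor
    · rintro rfl
      have := hβ p₀
      simp only [α₁, if_neg hp₀W] at this
      omega
    · intro p
      refine (hβ p).trans ?_
      simp only [α₁]
      split_ifs <;> simp
  have hM : bandMoment lam t (α + Pi.single e 1)
      = bandMoment lam t (α₁ + Pi.single e 1) * bandMoment lam t α₂ := by
    rw [← bandMoment_add (W := W) _ hα₂]
    · congr 1
      rw [hsplit, add_right_comm]
    · intro p hp
      by_cases hpe : p = e
      · subst hpe; exact ⟨h1, h2⟩
      · exact hα₁ p (by simpa [hpe] using hp)
  -- Isolate `β = α` in the recursion at `α` and restrict the other terms to `β ≤ α₁`; the terms so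
  -- dropped are shown at the end to vanish by induction.
  have hsum := sum_bandCumulant (lam := lam) (t := t) e α
  rw [← Finset.add_sum_erase _ _ (self_mem_multiIndexBelow α),
    ← Finset.sum_subset hsub, hM, ← sum_bandCumulant, Finset.sum_mul, multiChoose_self,
    tsub_self, bandMoment_zero] at hsum
  · have heq : ∀ β ∈ multiIndexBelow α₁,
        (multiChoose α β : ℝ) * bandCumulant lam t e β * bandMoment lam t (α - β)
          = multiChoose α₁ β * bandCumulant lam t e β * bandMoment lam t (α₁ - β)
            * bandMoment lam t α₂ := by
      intro β hβ
      rw [mem_multiIndexBelow] at hβ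
      have hc : multiChoose α β = multiChoose α₁ β := by
        refine Finset.prod_congr rfl fun p _ => ?_
        by_cases hp : p.1 ∈ W
        · simp [α₁, hp]
        · have := hβ p
          simp only [α₁, if_neg hp, Nat.le_zero] at this
          simp [this]
      have hm : α - β = (α₁ - β) + α₂ := by
        ext p
        have := hβ p
        have := congrFun hsplit p
        simp only [Pi.add_apply, Pi.sub_apply] at *
        omega
      rw [hc, hm, bandMoment_add (W := W) _ hα₂]
      · ring
      · intro p hp
        refine hα₁ p fun h0 => hp ?_
        simp [h0]
    rw [Finset.sum_congr rfl heq] at hsum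
    simpa using hsum
  · intro β hβ hβ₁
    have hlt := sum_lt_of_mem_erase_multiIndexBelow hβ
    rw [Finset.mem_erase, mem_multiIndexBelow] at hβ
    rw [mem_multiIndexBelow] at hβ₁
    push Not at hβ₁
    obtain ⟨p, hp⟩ := hβ₁
    -- Such a `β` has an edge outside `W`, and `W` is uncrossed by `β ≤ α`, so `β` is itself
    -- disconnected from `e`.
    have hpW : p.1 ∉ W := by
      intro hpW
      simp only [α₁, if_pos hpW] at hp
      exact absurd (hβ.2 p) (not_le.2 hp)
    have hconn : ¬ ConnectedTo e β := fun hcon =>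
      hpW (hcon W h1 h2 (fun r hr => hcross r (by have := hβ.2 r; omega)) p (by omega))
    rw [ih _ hlt hconn rfl]
    simp

/-- Explore from the single vertex `e.1`. The added edge `e` reaches `e.2`, and connectedness
reaches the rest. -/
theorem bandMoment_add_single_le (hlam : 0 ≤ lam) (ht : 0 ≤ t) {e : N × N} {α : N × N → ℕ}
    (h : ConnectedTo e α) : bandMoment lam t (α + Pi.single e 1)
      ≤ lam ^ (∑ p, α p + 1) * (2 * t) ^ ((vertexSet e α).card - 1) := by
  have hle := bandMoment_le (α := α + Pi.single e 1) (W := {e.1}) (U := vertexSet e α) hlam ht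
    (by simpa using fst_mem_vertexSet e α) ?_
  · rw [Finset.card_singleton] at hle
    convert hle using 3
    simp [Finset.sum_add_distrib]
  · intro W' hW' hW'U
    have h1 : e.1 ∈ W' := hW' (by simp)
    by_cases h2 : e.2 ∈ W'
    · obtain ⟨a, ha, b, hb, hbW, hedge⟩ := h.exists_crossing h1 h2 hW'U
      exact ⟨a, ha, b, hb, hbW, hedge.imp (fun h => by simp [h]) (fun h => by simp [h])⟩
    · exact ⟨e.1, h1, e.2, snd_mem_vertexSet e α, h2, Or.inl (by simp)⟩

/-- Explore from the vertices of `β`. An edge of `α` leaving a set that contains them is not an edge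
of `β`, hence survives in `α - β`. -/
theorem bandMoment_sub_le (hlam : 0 ≤ lam) (ht : 0 ≤ t) {e : N × N} {α β : N × N → ℕ}
    (h : ConnectedTo e α) (hβ : ∀ p, β p ≤ α p) : bandMoment lam t (α - β)
      ≤ lam ^ (∑ p, α p - ∑ p, β p)
        * (2 * t) ^ ((vertexSet e α).card - (vertexSet e β).card) := by
  have hle := bandMoment_le (α := α - β) (W := vertexSet e β) (U := vertexSet e α) hlam ht
    (vertexSet_mono e hβ) ?_
  · convert hle using 3
    simp only [Pi.sub_apply]
    rw [Finset.sum_tsub_distrib _ fun p _ => hβ p]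
  · intro W' hW' hW'U
    obtain ⟨a, ha, b, hb, hbW, hedge⟩ := h.exists_crossing (hW' (fst_mem_vertexSet e β))
      (hW' (snd_mem_vertexSet e β)) hW'U
    refine ⟨a, ha, b, hb, hbW, hedge.imp (fun h => ?_) (fun h => ?_)⟩
    · have h0 : β (a, b) = 0 := by
        by_contra h0
        exact hbW (hW' (endpoints_mem_vertexSet e h0).2)
      simpa [h0] using h
    · have h0 : β (b, a) = 0 := by
        by_contra h0
        exact hbW (hW' (endpoints_mem_vertexSet e h0).1)
      simpa [h0] using h

/-- In each term of the recursion the powers of `lam` and `2t` telescope to the same `Q`, because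
the moment of `α - β` pays for exactly the vertices that `β` misses. Only the combinatorial factor
has to be propagated by induction. -/
theorem abs_bandCumulant_le (hlam : 0 ≤ lam) (ht : 0 ≤ t) {e : N × N} {α : N × N → ℕ}
    (h : ConnectedTo e α) : |bandCumulant lam t e α|
      ≤ ((∑ p, α p : ℕ) + 1 : ℝ) ^ (∑ p, α p) * lam ^ (∑ p, α p + 1)
        * (2 * t) ^ ((vertexSet e α).card - 1) := by
  induction hd : ∑ p, α p using Nat.strong_induction_on generalizing α with
  | _ d ih =>
  set Q : ℝ := lam ^ (d + 1) * (2 * t) ^ ((vertexSet e α).card - 1) with hQ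
  have hQ0 : 0 ≤ Q := by positivity
  have hterm : ∀ β ∈ (multiIndexBelow α).erase α,
      |(multiChoose α β : ℝ) * bandCumulant lam t e β * bandMoment lam t (α - β)|
        ≤ multiChoose α β * (d : ℝ) ^ (∑ p, β p) * Q := by
    intro β hβ
    have hlt := sum_lt_of_mem_erase_multiIndexBelow hβ
    rw [hd] at hlt
    have hβα := mem_multiIndexBelow.1 (Finset.mem_of_mem_erase hβ)
    by_cases hcon : ConnectedTo e β
    · have hb := ih _ hlt hcon rfl
      have hm := bandMoment_sub_le hlam ht h hβα
      rw [hd] at hm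
      have hcard1 : 1 ≤ (vertexSet e β).card := Finset.card_pos.2 ⟨_, fst_mem_vertexSet e β⟩
      have hcard2 := Finset.card_le_card (vertexSet_mono e hβα)
      -- As `β` has fewer than `d` edges, its base `|β| + 1` is at most `d`; with this common base
      -- the sum over `β` is a binomial expansion of `(d + 1)^d`.
      have hpow : ((∑ p, β p : ℕ) + 1 : ℝ) ^ (∑ p, β p) ≤ (d : ℝ) ^ (∑ p, β p) := by
        refine pow_le_pow_left₀ (by positivity) ?_ _
        exact_mod_cast hlt
      rw [abs_mul, abs_mul, abs_of_nonneg (bandMoment_nonneg hlam _), Nat.abs_cast, mul_assoc,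
        mul_assoc]
      refine mul_le_mul_of_nonneg_left ?_ (Nat.cast_nonneg _)
      refine (mul_le_mul hb hm (bandMoment_nonneg hlam _) (by positivity)).trans ?_
      have hQ' : Q = (lam ^ (∑ p, β p + 1) * (2 * t) ^ ((vertexSet e β).card - 1))
          * (lam ^ (d - ∑ p, β p)
            * (2 * t) ^ ((vertexSet e α).card - (vertexSet e β).card)) := by
        rw [hQ, mul_mul_mul_comm, ← pow_add, ← pow_add]
        congr 2 <;> omega
      rw [hQ', mul_assoc _ (lam ^ (∑ p, β p + 1)), mul_assoc]
      refine mul_le_mul_of_nonneg_right hpow (by positivity)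
    · rw [bandCumulant_eq_zero e hcon]
      simp only [mul_zero, zero_mul, abs_zero]
      positivity
  have hsum := sum_multiChoose_mul_pow α (d : ℝ)
  rw [← Finset.add_sum_erase _ _ (self_mem_multiIndexBelow α), multiChoose_self, hd] at hsum
  have hM := bandMoment_add_single_le hlam ht h
  rw [hd] at hM
  -- The term `β = α` of that expansion, equal to `d^d`, is absent from the recursion and pays for
  -- the moment term. For `d = 0` it is `0^0 = 1`.
  have hdd : (1 : ℝ) ≤ (d : ℝ) ^ d := by
    rcases Nat.eq_zero_or_pos d with rfl | hpos
    · simp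
    · exact one_le_pow₀ (by exact_mod_cast hpos)
  calc |bandCumulant lam t e α|
      = |bandMoment lam t (α + Pi.single e 1) - ∑ β ∈ (multiIndexBelow α).erase α,
          (multiChoose α β : ℝ) * bandCumulant lam t e β * bandMoment lam t (α - β)| := by
        rw [bandCumulant, cumulant_eq]
    _ ≤ Q + ∑ β ∈ (multiIndexBelow α).erase α,
          multiChoose α β * (d : ℝ) ^ (∑ p, β p) * Q := by
        refine (abs_sub _ _).trans (add_le_add ?_ ?_)
        · rwa [abs_of_nonneg (bandMoment_nonneg hlam _)]
        · exact (Finset.abs_sum_le_sum_abs _ _).trans (Finset.sum_le_sum hterm)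
    _ = (1 + ∑ β ∈ (multiIndexBelow α).erase α,
          multiChoose α β * (d : ℝ) ^ (∑ p, β p)) * Q := by
        rw [add_mul, one_mul, Finset.sum_mul]
    _ ≤ ((d : ℝ) + 1) ^ d * Q := by
        refine mul_le_mul_of_nonneg_right ?_ hQ0
        push_cast at hsum
        linarith
    _ = _ := by rw [hQ, mul_assoc]

end Cumulants

/-! ### Summation of the squared cumulants -/

section Summation

variable {N : Type*} [Fintype N] [DecidableEq N] {lam t : ℝ}

/-- The multinomial theorem for `(1 + ⋯ + 1)^d`, divided by `d!`. -/
theorem sum_piAntidiag_inv_factorial {ι : Type*} [Fintype ι] [DecidableEq ι] (s : Finset ι)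
    (d : ℕ) : ∑ α ∈ s.piAntidiag d, (∏ p, ((α p).factorial : ℝ))⁻¹
      = (s.card : ℝ) ^ d / d.factorial := by
  have h := Finset.sum_pow_eq_sum_piAntidiag s (fun _ => (1 : ℝ)) d
  simp only [Finset.sum_const, nsmul_eq_mul, mul_one, one_pow, Finset.prod_const_one] at h
  rw [h, Finset.sum_div]
  refine Finset.sum_congr rfl fun α hα => ?_
  rw [Finset.mem_piAntidiag] at hα
  have h1 : ∏ p, (α p).factorial = ∏ p ∈ s, (α p).factorial := by
    refine (Finset.prod_subset (Finset.subset_univ s) fun p _ hp => ?_).symm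
    have : α p = 0 := by
      by_contra h0
      exact hp (hα.2 p h0)
    simp [this]
  have h2 := Nat.multinomial_spec s α
  rw [hα.1, ← h1] at h2
  have h3 : (∏ p, ((α p).factorial : ℝ)) * Nat.multinomial s α = d.factorial := by
    exact_mod_cast h2
  have h4 : (d.factorial : ℝ) ≠ 0 := by exact_mod_cast d.factorial_ne_zero
  have h5 := prod_factorial_ne_zero α
  rw [inv_eq_one_div, div_eq_div_iff h5 h4, one_mul, mul_comm, h3]

/-- Removing `s` is injective on supersets of `s`, and summing `x ^ |T|` over all subsets gives a
product of factors `1 + x`. -/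
theorem sum_pow_card_sdiff_le {x : ℝ} (hx : 0 ≤ x) (s : Finset N) :
    ∑ U ∈ Finset.univ.filter (fun U : Finset N => s ⊆ U), x ^ (U \ s).card
      ≤ (1 + x) ^ Fintype.card N := by
  have hinj : Set.InjOn (fun U : Finset N => U \ s)
      (Finset.univ.filter (fun U : Finset N => s ⊆ U)) := by
    intro U hU U' hU' h
    simp only [Finset.coe_filter, Finset.mem_univ, true_and, Set.mem_ofPred_eq] at hU hU' h
    rw [← Finset.sdiff_union_of_subset hU, ← Finset.sdiff_union_of_subset hU', h]
  rw [← Finset.sum_image (f := fun T : Finset N => x ^ T.card) hinj]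
  calc _ ≤ ∑ T : Finset N, x ^ T.card :=
        Finset.sum_le_sum_of_subset_of_nonneg (Finset.subset_univ _) fun _ _ _ => by positivity
    _ = (1 + x) ^ Fintype.card N := by
        rw [← Finset.card_univ, ← Finset.prod_const, Finset.prod_one_add]
        simp

theorem one_add_pow_le_two {x : ℝ} (n : ℕ) (hx : 0 ≤ x) (h : n * x ≤ 1 / 2) :
    (1 + x) ^ n ≤ 2 := by
  have h1 : (1 + x) ^ n ≤ Real.exp (n * x) := by
    rw [Real.exp_nat_mul]
    exact pow_le_pow_left₀ (by linarith) (by linarith [Real.add_one_le_exp x]) n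
  have h2 : Real.exp (n * x) ≤ Real.exp (1 / 2) := Real.exp_le_exp.2 h
  have h3 : Real.exp (1 / 2) ^ 2 = Real.exp 1 := by
    rw [← Real.exp_nat_mul]
    norm_num
  nlinarith [Real.exp_one_lt_d9, Real.exp_pos (1 / 2)]

theorem two_pow_le_two_mul_factorial (d : ℕ) : 2 ^ d ≤ 2 * d.factorial := by
  induction d with
  | zero => simp
  | succ d ih =>
    rcases Nat.eq_zero_or_pos d with rfl | hd
    · simp
    · rw [pow_succ, Nat.factorial_succ]
      nlinarith [d.factorial_pos]

theorem sum_bandCumulant_sq_le_sum_finset (hlam : 0 ≤ lam) (ht : 0 ≤ t) (e : N × N) (d : ℕ) :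
    ∑ α ∈ Finset.piAntidiag Finset.univ d,
        bandCumulant lam t e α ^ 2 / ∏ p, ((α p).factorial : ℝ)
      ≤ ∑ U ∈ Finset.univ.filter (fun U : Finset N => {e.1, e.2} ⊆ U),
        (((d : ℝ) + 1) ^ d * lam ^ (d + 1) * (2 * t) ^ (U.card - 1)) ^ 2
          * ((2 * (d : ℝ) + 2) ^ (2 * d) / d.factorial) := by
  have hmaps : ∀ α ∈ Finset.piAntidiag (Finset.univ : Finset (N × N)) d,
      vertexSet e α ∈ Finset.univ.filter (fun U : Finset N => {e.1, e.2} ⊆ U) := by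
    intro α _
    simp [Finset.insert_subset_iff, fst_mem_vertexSet, snd_mem_vertexSet]
  rw [← Finset.sum_fiberwise_of_maps_to hmaps]
  refine Finset.sum_le_sum fun U hU => ?_
  set B : ℝ := (((d : ℝ) + 1) ^ d * lam ^ (d + 1) * (2 * t) ^ (U.card - 1)) ^ 2 with hB
  have hfact : ∀ α : N × N → ℕ, 0 ≤ (∏ p, ((α p).factorial : ℝ))⁻¹ := fun α => by positivity
  -- A larger `U` is never the vertex set of `e` together with `d` edges, so its fibre is empty.
  by_cases hcard : U.card ≤ 2 * d + 2
  · calc _ ≤ ∑ α ∈ (Finset.piAntidiag (Finset.univ : Finset (N × N)) d).filter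
            (fun α => vertexSet e α = U), B * (∏ p, ((α p).factorial : ℝ))⁻¹ := by
          refine Finset.sum_le_sum fun α hα => ?_
          simp only [Finset.mem_filter, Finset.mem_piAntidiag] at hα
          rw [div_eq_mul_inv]
          refine mul_le_mul_of_nonneg_right ?_ (hfact α)
          by_cases hcon : ConnectedTo e α
          · have h := abs_bandCumulant_le hlam ht hcon
            rw [hα.1.1, hα.2] at h
            rw [← sq_abs, hB]
            exact pow_le_pow_left₀ (abs_nonneg _) h 2
          · rw [bandCumulant_eq_zero e hcon, hB, zero_pow two_ne_zero]
            exact sq_nonneg _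
      -- Forget that the vertex set equals `U`; keep only that every edge lies in `U × U`.
      _ ≤ ∑ α ∈ (U ×ˢ U).piAntidiag d, B * (∏ p, ((α p).factorial : ℝ))⁻¹ := by
          refine Finset.sum_le_sum_of_subset_of_nonneg ?_ fun α _ _ =>
            mul_nonneg (by positivity) (hfact α)
          intro α hα
          simp only [Finset.mem_filter, Finset.mem_piAntidiag] at hα
          obtain ⟨⟨hsum, -⟩, rfl⟩ := hα
          have hin : ∀ p, α p ≠ 0 → p ∈ vertexSet e α ×ˢ vertexSet e α := fun p hp =>
            Finset.mem_product.2 (endpoints_mem_vertexSet e hp)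
          refine Finset.mem_piAntidiag.2 ⟨?_, hin⟩
          rw [← hsum]
          refine Finset.sum_subset (Finset.subset_univ _) fun p _ hp => ?_
          by_contra h0
          exact hp (hin p h0)
      _ = B * (((U.card : ℝ)) ^ (2 * d) / d.factorial) := by
          rw [← Finset.mul_sum, sum_piAntidiag_inv_factorial, Finset.card_product]
          push_cast
          rw [← sq, ← pow_mul]
      _ ≤ _ := by
          refine mul_le_mul_of_nonneg_left ?_ (by positivity)
          have : (U.card : ℝ) ≤ 2 * d + 2 := by exact_mod_cast hcard
          gcongr
  · rw [Finset.sum_eq_zero]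
    · positivity
    · intro α hα
      simp only [Finset.mem_filter, Finset.mem_piAntidiag] at hα
      have := card_vertexSet_le e α
      rw [hα.1.1, hα.2] at this
      exact absurd this hcard

theorem sum_bandCumulant_sq_le_pow (hlam : 0 ≤ lam) (ht : 0 ≤ t)
    (hN : Fintype.card N * (2 * t) ^ 2 ≤ 1 / 2) {e : N × N} (he : e.1 ≠ e.2) {d D : ℕ}
    (hd : d ≤ D) :
    ∑ α ∈ Finset.piAntidiag Finset.univ d,
        bandCumulant lam t e α ^ 2 / ∏ p, ((α p).factorial : ℝ)
      ≤ 4 * (lam * (2 * t)) ^ 2 * (2 * lam ^ 2 * ((D : ℝ) + 1) ^ 4) ^ d := by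
  refine (sum_bandCumulant_sq_le_sum_finset hlam ht e d).trans ?_
  -- Here `(d+1)^(2d) * (2d+2)^(2d) = 4^d * (d+1)^(4d)`. One factor `2^d` goes into the ratio `r₀`,
  -- the other is absorbed by `d!`. One factor `(2t)²` comes out since `|U| - 1 = |U \ {e.1, e.2}| +
  -- 1`.
  have hcard : ∀ U ∈ Finset.univ.filter (fun U : Finset N => {e.1, e.2} ⊆ U),
      (((d : ℝ) + 1) ^ d * lam ^ (d + 1) * (2 * t) ^ (U.card - 1)) ^ 2
          * ((2 * (d : ℝ) + 2) ^ (2 * d) / d.factorial)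
        = (lam * (2 * t)) ^ 2 * (2 * lam ^ 2 * ((d : ℝ) + 1) ^ 4) ^ d * (2 ^ d / d.factorial)
          * ((2 * t) ^ 2) ^ (U \ {e.1, e.2}).card := by
    intro U hU
    have hsub : {e.1, e.2} ⊆ U := (Finset.mem_filter.1 hU).2
    have hc := Finset.card_sdiff_add_card_eq_card hsub
    rw [Finset.card_pair he] at hc
    have hc' : U.card - 1 = (U \ {e.1, e.2}).card + 1 := by omega
    rw [hc', show 2 * (d : ℝ) + 2 = 2 * (d + 1) by ring]
    have h2 : (2 : ℝ) ^ (2 * d) = 2 ^ d * 2 ^ d := by rw [two_mul, pow_add]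
    simp only [mul_pow, ← pow_mul, h2]
    ring
  rw [Finset.sum_congr rfl hcard, ← Finset.mul_sum]
  have h1 : ∑ U ∈ Finset.univ.filter (fun U : Finset N => {e.1, e.2} ⊆ U),
      ((2 * t) ^ 2) ^ (U \ {e.1, e.2}).card ≤ 2 :=
    (sum_pow_card_sdiff_le (sq_nonneg _) _).trans (one_add_pow_le_two _ (sq_nonneg _) hN)
  have h2 : (2 : ℝ) ^ d / d.factorial ≤ 2 := by
    rw [div_le_iff₀ (by exact_mod_cast d.factorial_pos)]
    exact_mod_cast two_pow_le_two_mul_factorial d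
  have h3 : (2 * lam ^ 2 * ((d : ℝ) + 1) ^ 4) ^ d ≤ (2 * lam ^ 2 * ((D : ℝ) + 1) ^ 4) ^ d := by
    have : (d : ℝ) ≤ D := by exact_mod_cast hd
    gcongr
  calc _ ≤ (lam * (2 * t)) ^ 2 * (2 * lam ^ 2 * ((D : ℝ) + 1) ^ 4) ^ d * 2 * 2 := by
        gcongr
    _ = _ := by ring

theorem sum_bandCumulant_sq_le (hlam : 0 ≤ lam) (ht : 0 ≤ t)
    (hN : Fintype.card N * (2 * t) ^ 2 ≤ 1 / 2) {e : N × N} (he : e.1 ≠ e.2) {D : ℕ} {r : ℝ}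
    (hr : r = 2 * lam ^ 2 * ((D : ℝ) + 1) ^ 4) (hr1 : r < 1) :
    ∑ α ∈ multiIndexDegLE (N × N) D,
        bandCumulant lam t e α ^ 2 / ∏ p, ((α p).factorial : ℝ)
      ≤ (lam * (2 * t)) ^ 2 * (1 + 4 * (r / (1 - r))) := by
  have hr0 : 0 ≤ r := by rw [hr]; positivity
  rw [sum_multiIndexDegLE, Finset.sum_range_succ']
  -- Degree `0` is bounded directly, without the factor `4` lost in the general estimate.
  have h0 : ∑ α ∈ Finset.piAntidiag Finset.univ 0,
      bandCumulant lam t e α ^ 2 / ∏ p, ((α p).factorial : ℝ) ≤ (lam * (2 * t)) ^ 2 := by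
    have hcon : ConnectedTo e 0 := fun _ _ _ _ p hp => absurd rfl hp
    have h := abs_bandCumulant_le hlam ht hcon
    have hU : vertexSet e 0 = {e.1, e.2} := by
      ext a
      simp [mem_vertexSet]
    rw [hU, Finset.card_pair he] at h
    simp only [Pi.zero_apply, Finset.sum_const_zero, pow_zero, zero_add, pow_one, one_mul] at h
    rw [Finset.piAntidiag_zero, Finset.sum_singleton, ← sq_abs]
    simp only [Pi.zero_apply, Nat.factorial_zero, Nat.cast_one, Finset.prod_const_one, div_one]
    exact pow_le_pow_left₀ (abs_nonneg _) (by simpa using h) 2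
  have h1 : ∑ d ∈ Finset.range D, ∑ α ∈ Finset.piAntidiag Finset.univ (d + 1),
      bandCumulant lam t e α ^ 2 / ∏ p, ((α p).factorial : ℝ)
        ≤ 4 * (lam * (2 * t)) ^ 2 * (r / (1 - r)) := by
    calc _ ≤ ∑ d ∈ Finset.range D, 4 * (lam * (2 * t)) ^ 2 * (r * r ^ d) := by
          refine Finset.sum_le_sum fun d hd => ?_
          have := sum_bandCumulant_sq_le_pow hlam ht hN he
            (Nat.succ_le_of_lt (Finset.mem_range.1 hd))
          rw [← hr] at this
          rwa [pow_succ' r] at this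
      _ = 4 * (lam * (2 * t)) ^ 2 * (r * ∑ d ∈ Finset.range D, r ^ d) := by
          rw [← Finset.mul_sum, ← Finset.mul_sum]
      _ ≤ _ := by
          rw [div_eq_mul_inv]
          gcongr
          rw [← tsum_geometric_of_lt_one hr0 hr1]
          exact (summable_geometric_of_lt_one hr0 hr1).sum_le_tsum _ fun _ _ => by positivity
  linarith

theorem le_integral_bandEntry_sq {e : N × N} (he : e.1 ≠ e.2) (ht : 0 ≤ t) :
    lam ^ 2 * (2 * t - 4 * t ^ 2) ≤ ∫ v, bandEntry lam t v e ^ 2 ∂unifPi N := by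
  have hB : MeasurableSet {v : N → ℝ | |v e.1 - v e.2| ≤ t} :=
    measurableSet_le ((measurable_pi_apply e.1).sub (measurable_pi_apply e.2)).abs
      measurable_const
  have h : ∀ v : N → ℝ, bandEntry lam t v e ^ 2
      = {v : N → ℝ | |v e.1 - v e.2| ≤ t}.indicator (fun _ => lam ^ 2) v := by
    intro v
    by_cases hv : |v e.1 - v e.2| ≤ t
    · rw [bandEntry, bandFunction_of_le hv, Set.indicator_of_mem (by exact hv)]
    · rw [bandEntry, bandFunction_of_not_le hv, Set.indicator_of_notMem (by exact hv)]
      simp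
  simp only [h]
  rw [integral_indicator_const _ hB, smul_eq_mul, mul_comm]
  exact mul_le_mul_of_nonneg_right (le_unifPi_near he ht) (sq_nonneg _)

/-- Lower bound for the estimation of an off-diagonal entry of the signal by a polynomial. -/
theorem le_integral_entry_error (hlam : 0 ≤ lam) (ht : 0 ≤ t)
    (hN : Fintype.card N * (2 * t) ^ 2 ≤ 1 / 2) {e : N × N} (he : e.1 ≠ e.2) {D : ℕ} {r : ℝ}
    (hr : r = 2 * lam ^ 2 * ((D : ℝ) + 1) ^ 4) (hr1 : r < 1) {f : MvPolynomial (N × N) ℝ}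
    (hf : f.totalDegree ≤ D) :
    lam ^ 2 * (2 * t - 4 * t ^ 2) - (lam * (2 * t)) ^ 2 * (1 + 4 * (r / (1 - r)))
      ≤ ∫ w, (MvPolynomial.eval (bandEntry lam t w.1 + w.2) f - bandEntry lam t w.1 e) ^ 2
        ∂(unifPi N).prod (stdGaussianPi (N × N)) := by
  have h := le_integral_sq_sub (ξ := fun v => bandEntry lam t v)
    (fun p => hasFiniteMoments_bandEntry lam t p) (hasFiniteMoments_bandEntry lam t e)
    (κ := bandCumulant lam t e) (D := D) (fun γ _ => ?_) (mvPolynomial_eval_mem_hermiteSpan f hf)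
  · linarith [le_integral_bandEntry_sq (lam := lam) he ht,
      sum_bandCumulant_sq_le hlam ht hN he hr hr1]
  -- The condition on `κ` is the cumulant recursion, once the moment of `γ + e` is read as the
  -- expectation of `x` times the monomial `γ`.
  · refine (sum_bandCumulant e γ).trans ?_
    rw [bandMoment]
    congr with v
    simp only [Pi.add_apply, pow_add]
    rw [Finset.prod_mul_distrib, mul_comm]
    congr 1
    rw [← Finset.mul_prod_erase _ _ (Finset.mem_univ e), Finset.prod_eq_one]
    · simp
    · intro p hp
      simp [Finset.ne_of_mem_erase hp]

end Summation

/-! ### From single entries to the Frobenius error -/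

/-- The joint law of the latent positions and the noise. -/
theorem map_positions_noise {Ω : Type*} [MeasurableSpace Ω] {P : Measure Ω}
    [IsProbabilityMeasure P] {N ι : Type*} [Fintype N] [Fintype ι] {V : N → Ω → ℝ}
    {E : ι → Ω → ℝ} (hV : ∀ i, HasLaw (V i) unifUnit P)
    (hE : ∀ p, HasLaw (E p) (gaussianReal 0 1) P) (hindep : iIndepFun (Sum.elim V E) P) :
    HasLaw (fun ω => (fun i => V i ω, fun p => E p ω)) ((unifPi N).prod (stdGaussianPi ι)) P := by
  let ν : N ⊕ ι → Measure ℝ := Sum.elim (fun _ => unifUnit) fun _ => gaussianReal 0 1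
  have hlaw : ∀ s, HasLaw (Sum.elim V E s) (ν s) P := by
    rintro (i | p)
    · exact hV i
    · exact hE p
  have hν : ∀ s, IsProbabilityMeasure (ν s) := by
    rintro (i | p)
    · exact inferInstanceAs (IsProbabilityMeasure unifUnit)
    · exact inferInstanceAs (IsProbabilityMeasure (gaussianReal 0 1))
  have hpi : HasLaw (fun ω s => Sum.elim V E s ω) (Measure.pi ν) P := by
    refine ⟨aemeasurable_pi_lambda _ fun s => (hlaw s).aemeasurable, ?_⟩
    rw [(iIndepFun_iff_map_fun_eq_pi_map fun s => (hlaw s).aemeasurable).1 hindep]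
    congr with s : 1
    exact (hlaw s).map_eq
  have hmp := measurePreserving_sumPiEquivProdPi ν
  exact hmp.hasLaw.comp hpi

theorem mainTheorem4 {Ω : Type*} [MeasurableSpace Ω] (P : Measure Ω) [IsProbabilityMeasure P]
    (n k D : ℕ) (hk : 0 < k) (hD : 0 < D) (lam : ℝ) (hlam₀ : 0 < lam) (hlam₁ : lam < 1)
    (V : Fin n → Ω → ℝ) (E : Ω → Matrix (Fin n) (Fin n) ℝ)
    (hV : ∀ i, HasLaw (V i) (volume.restrict (Set.Icc (0 : ℝ) 1)) P)
    (hE : ∀ i j, HasLaw (fun ω => E ω i j) (gaussianReal 0 1) P)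
    (hindep : iIndepFun
      (Sum.elim V (fun (p : Fin n × Fin n) ω => E ω p.1 p.2)) P)
    (X Y : Ω → Matrix (Fin n) (Fin n) ℝ)
    (hX : ∀ ω, X ω = latentMatrix (bandFunction lam ((k : ℝ) / n)) (fun i => V i ω))
    (hY : ∀ ω, Y ω = X ω + E ω)
    (r₀ : ℝ) (hr₀ : r₀ = 2 * lam ^ 2 * ((D : ℝ) + 1) ^ 4) (hr₀_lt : r₀ < 1)
    (hkn : (2 * (k : ℝ) + 1) ^ 2 ≤ (n : ℝ) / 2) :
    lam ^ 2 * 2 * k * ((n : ℝ) - 1)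
        - 4 * lam ^ 2 * (k : ℝ) ^ 2 * (3 + 5 * r₀ / (1 - r₀))
      ≤ lowDegreeMMSE P X Y D := by
  have hk1 : (1 : ℝ) ≤ k := by exact_mod_cast hk
  have hn : (1 : ℝ) ≤ n := by nlinarith
  have hn0 : (n : ℝ) ≠ 0 := by positivity
  have hr_nonneg : 0 ≤ r₀ := by rw [hr₀]; positivity
  have hρ : 0 ≤ r₀ / (1 - r₀) := div_nonneg hr_nonneg (by linarith)
  set t : ℝ := (k : ℝ) / n with ht_def
  have ht : 0 ≤ t := by positivity
  have hnt : n * t = k := by rw [ht_def]; field_simp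
  -- This amounts to `4k² ≤ n / 2`, which follows from `hkn`.
  have hN : (Fintype.card (Fin n) : ℝ) * (2 * t) ^ 2 ≤ 1 / 2 := by
    rw [Fintype.card_fin]
    have h1 : (n : ℝ) * (2 * t) ^ 2 = 4 * k ^ 2 / n := by
      rw [ht_def]
      field_simp
      ring
    rw [h1, div_le_iff₀ (by positivity)]
    nlinarith
  have hlaw := map_positions_noise hV (fun p : Fin n × Fin n => hE p.1 p.2) hindep
  have : Nonempty {f : Matrix (Fin n) (Fin n) (MvPolynomial (Fin n × Fin n) ℝ) //
      ∀ i j, (f i j).totalDegree ≤ D} := ⟨⟨0, fun i j => by simp⟩⟩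
  refine le_ciInf fun ⟨f, hf⟩ => ?_
  let G (i j : Fin n) (w : (Fin n → ℝ) × (Fin n × Fin n → ℝ)) : ℝ :=
    (MvPolynomial.eval (bandEntry lam t w.1 + w.2) (f i j) - bandEntry lam t w.1 (i, j)) ^ 2
  have hG : ∀ i j, HasFiniteMoments (G i j)
      ((unifPi (Fin n)).prod (stdGaussianPi (Fin n × Fin n))) := fun i j =>
    ((hasFiniteMoments_hermiteSpan_comp
      (fun p => (hasFiniteMoments_signal (hasFiniteMoments_bandEntry lam t p)).add
        (hasFiniteMoments_noise p))
      (mvPolynomial_eval_mem_hermiteSpan (f i j) (hf i j))).sub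
      (hasFiniteMoments_signal (hasFiniteMoments_bandEntry lam t (i, j)))).pow 2
  have hloss : ∫ ω, frobeniusSq (polyEval f (Y ω) - X ω) ∂P = ∑ i, ∑ j,
      ∫ w, G i j w ∂(unifPi (Fin n)).prod (stdGaussianPi (Fin n × Fin n)) := by
    have hS := HasFiniteMoments.sum Finset.univ fun i _ =>
      HasFiniteMoments.sum Finset.univ fun j _ => hG i j
    have h1 := hlaw.integral_comp hS.integrable.aestronglyMeasurable
    rw [integral_finsetSum _ fun i _ =>
      integrable_finsetSum _ fun j _ => (hG i j).integrable] at h1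
    simp only [integral_finsetSum _ fun j _ => (hG _ j).integrable] at h1
    rw [← h1]
    congr with ω
    simp only [frobeniusSq, polyEval, hY, hX, G, Function.comp_apply]
    rfl
  have hentry : ∀ i j, (if i = j then 0 else
      lam ^ 2 * (2 * t - 4 * t ^ 2) - (lam * (2 * t)) ^ 2 * (1 + 4 * (r₀ / (1 - r₀))))
        ≤ ∫ w, G i j w ∂(unifPi (Fin n)).prod (stdGaussianPi (Fin n × Fin n)) := by
    intro i j
    split_ifs with hij
    · exact integral_nonneg fun _ => sq_nonneg _
    · exact le_integral_entry_error hlam₀.le ht hN (e := (i, j)) hij hr₀ hr₀_lt (hf i j)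
  change _ ≤ ∫ ω, frobeniusSq (polyEval f (Y ω) - X ω) ∂P
  rw [hloss]
  refine le_trans ?_ (Finset.sum_le_sum fun i _ => Finset.sum_le_sum fun j _ => hentry i j)
  set c := lam ^ 2 * (2 * t - 4 * t ^ 2) - (lam * (2 * t)) ^ 2 * (1 + 4 * (r₀ / (1 - r₀)))
    with hc
  have hsum : ∑ i : Fin n, ∑ j : Fin n, (if i = j then 0 else c) = n * (n - 1) * c := by
    have hrow : ∀ i : Fin n, ∑ j : Fin n, (if i = j then 0 else c) = (n - 1) * c := by
      intro i
      have h : ∀ j : Fin n, (if i = j then 0 else c) = c - if i = j then c else 0 := by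
        intro j
        split_ifs <;> ring
      simp only [h, Finset.sum_sub_distrib, Finset.sum_ite_eq, Finset.mem_univ, if_true,
        Finset.sum_const, Finset.card_univ, Fintype.card_fin, nsmul_eq_mul]
      ring
    simp only [hrow, Finset.sum_const, Finset.card_univ, Fintype.card_fin, nsmul_eq_mul]
    ring
  rw [hsum, hc, mul_div_assoc, ← hnt]
  generalize r₀ / (1 - r₀) = ρ at hρ
  -- The entrywise bounds give loss `4 lam² t² n (n - 1) (2 + 4ρ)`, while `4 lam² t² n² (3 + 5ρ)` is
  -- allowed; the slack is exactly four times the sum of the quantities in `h1` and `h2`.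
  have h1 : 0 ≤ lam ^ 2 * t ^ 2 * n * (2 + 4 * ρ) := by positivity
  have h2 : 0 ≤ lam ^ 2 * t ^ 2 * n ^ 2 * (1 + ρ) := by positivity
  nlinarith
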